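/- **Closed form of the average subentropy.** For a density matrix $\rho$ on $\mathbb{C}^m$ with eigenvalues $\Lambda=(\lambda_1,\dots,\lambda_m)$ the (quantum) subentropy is $$Q(\rho)=Q(\Lambda)=-\sum_{i=1}^m\frac{\lambda_i^m}{\prod_{j\neq i}(\lambda_i-\lambda_j)}\ln\lambda_i ,$$ with the value for repeated eigenvalues determined by taking the limit along probability vectors with distinct entries. For $\alpha,\gamma>0$ let $\nu_{\alpha,\gamma}$ be the probability measure on the simplex $\{\lambda\in[0,\infty)^m:\sum_j\lambda_j=1\}$ proportional to $$\delta\Bigl(1-\sum_{j=1}^m\lambda_j\Bigr)\prod_{i<j}|\lambda_i-\lambda_j|^{2\gamma}\prod_{j=1}^m\lambda_j^{\alpha-1}\,d\lambda_j ,$$ and put $\mathcal I^Q_m(\alpha,\gamma)=\int Q(\Lambda)\,d\nu_{\alpha,\gamma}(\Lambda)$. Let $\mu_{m(n)}$ be the distribution of $\rho=\mathrm{Tr}_{\mathbb{C}^n}|\Psi\rangle\langle\Psi|$, where $\Psi$ is a uniformly (Haar) distributed unit vector of $\mathbb{C}^m\otimes\mathbb{C}^n$. Let $H_k=\sum_{i=1}^k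 1/i$ and let $\gamma_{\mathrm{Euler}}$ be Euler's constant. 1. For all integers $1\le m\le n$, the subentropy is integrable with respect to $\mu_{m(n)}$ and $\nu_{n-m+1,1}$, and its average over random mixed states is $$\int Q(\rho)\,d\mu_{m(n)}(\rho)=\mathcal I^Q_m(n-m+1,1)=1+H_{mn}-H_m-H_n .$$ 2. Consequently, for every choice of integers $n=n(m)\ge m$, $$\lim_{m\to\infty}\mathcal I^Q_m(n-m+1,1)=1-\gamma_{\mathrm{Euler}},$$ and $1-\gamma_{\mathrm{Euler}}$ is the maximal value of the subentropy in the sense that it is the supremum of $Q(\rho)$ over all density matrices $\rho$ of all finite dimensions. -/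

import Mathlib

open scoped ComplexOrder

noncomputable section

/-- Density matrices on `ℂ^m`: positive semidefinite matrices of trace one. -/
def DensityMatrix (m : ℕ) : Type :=
  {ρ : Matrix (Fin m) (Fin m) ℂ // ρ.PosSemidef ∧ ρ.trace = 1}

instance (m : ℕ) : TopologicalSpace (DensityMatrix m) :=
  inferInstanceAs
    (TopologicalSpace {ρ : Matrix (Fin m) (Fin m) ℂ // ρ.PosSemidef ∧ ρ.trace = 1})

instance (m : ℕ) : MeasurableSpace (DensityMatrix m) := borel _

instance (m : ℕ) : BorelSpace (DensityMatrix m) := ⟨rfl⟩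

/-- The spectrum `(λ₁, …, λ_m)` of a density matrix, with multiplicity. -/
def DensityMatrix.spectrum {m : ℕ} (ρ : DensityMatrix m) : Fin m → ℝ :=
  ρ.2.1.isHermitian.eigenvalues

/-! ### Subentropy -/

/-- `-∑ i, λ_i ^ m * log λ_i / ∏_{j ≠ i} (λ_i - λ_j)`, the subentropy of a spectrum
without repeated eigenvalues. -/
def subentropyFormula {m : ℕ} (x : Fin m → ℝ) : ℝ :=
  -∑ i, x i ^ m / (∏ j ∈ Finset.univ.erase i, (x i - x j)) * Real.log (x i)

/-- Probability vectors with pairwise distinct entries. -/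
def simpleSpectra (m : ℕ) : Set (Fin m → ℝ) :=
  {x | x ∈ stdSimplex ℝ (Fin m) ∧ Function.Injective x}

/-- The subentropy `Q(Λ)` of a spectrum: the limit of the formula along spectra with unequal
eigenvalues, which for a spectrum with unequal eigenvalues is the formula itself. -/
def spectralSubentropy {m : ℕ} (x : Fin m → ℝ) : ℝ :=
  extendFrom (simpleSpectra m) subentropyFormula x

/-- The subentropy `Q(ρ)` of a density matrix. -/
def DensityMatrix.subentropy {m : ℕ} (ρ : DensityMatrix m) : ℝ :=
  spectralSubentropy ρ.spectrum

/-! ### The measure induced by partial tracing -/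

/-- Bipartite pure states: unit vectors of `ℂ^m ⊗ ℂ^n`, in coordinates. -/
abbrev PureState (m n : ℕ) : Type :=
  Metric.sphere (0 : EuclideanSpace ℂ (Fin m × Fin n)) 1

/-- The partial trace over the second tensor factor. -/
def partialTraceRight {m n : ℕ} (M : Matrix (Fin m × Fin n) (Fin m × Fin n) ℂ) :
    Matrix (Fin m) (Fin m) ℂ :=
  Matrix.of fun i j => ∑ k, M (i, k) (j, k)

/-- The projector `|Ψ⟩⟨Ψ|`. -/
def PureState.projector {m n : ℕ} (ψ : PureState m n) :
    Matrix (Fin m × Fin n) (Fin m × Fin n) ℂ :=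
  Matrix.of fun p q => ψ.1 p * star (ψ.1 q)

theorem PureState.reduced_isDensity {m n : ℕ} (ψ : PureState m n) :
    (partialTraceRight ψ.projector).PosSemidef ∧ (partialTraceRight ψ.projector).trace = 1 := by
  constructor
  · have h : partialTraceRight ψ.projector =
        (Matrix.of fun (i : Fin m) (k : Fin n) => ψ.1 (i, k)) *
          (Matrix.of fun (i : Fin m) (k : Fin n) => ψ.1 (i, k)).conjTranspose := by
      ext i j
      simp [partialTraceRight, PureState.projector, Matrix.mul_apply]
    rw [h]
    exact Matrix.posSemidef_self_mul_conjTranspose _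
  · have h1 : ‖ψ.1‖ ^ 2 = 1 := by
      rw [mem_sphere_zero_iff_norm.1 ψ.2, one_pow]
    rw [EuclideanSpace.norm_sq_eq, Fintype.sum_prod_type] at h1
    simp only [Matrix.trace, partialTraceRight, PureState.projector, Matrix.diag_apply,
      Matrix.of_apply, RCLike.star_def, Complex.mul_conj']
    exact_mod_cast h1

/-- The reduced state `Tr_B |Ψ⟩⟨Ψ|` of a bipartite pure state. -/
def PureState.reduced {m n : ℕ} (ψ : PureState m n) : DensityMatrix m :=
  ⟨partialTraceRight ψ.projector, ψ.reduced_isDensity⟩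

/-- The unitarily invariant (uniform) probability measure on bipartite pure states. -/
def uniformPureState (m n : ℕ) : MeasureTheory.Measure (PureState m n) :=
  ((MeasureTheory.volume : MeasureTheory.Measure
      (EuclideanSpace ℂ (Fin m × Fin n))).toSphere Set.univ)⁻¹ •
    (MeasureTheory.volume : MeasureTheory.Measure
      (EuclideanSpace ℂ (Fin m × Fin n))).toSphere

/-- The measure on density matrices induced by partial tracing uniformly distributed pure
states of `ℂ^m ⊗ ℂ^n` over the `n`-dimensional ancilla. -/
def inducedMeasure (m n : ℕ) : MeasureTheory.Measure (DensityMatrix m) :=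
  (uniformPureState m n).map PureState.reduced

/-! ### The eigenvalue measures `ν_{α,γ}` -/

/-- The measure `δ(1 - ∑ j, λ_j) ∏ j, dλ_j` on `[0, ∞)^m`: Lebesgue measure in
`(λ₂, …, λ_m)`, with `λ₁ = 1 - ∑_{j ≥ 2} λ_j`. -/
def simplexMeasure : (m : ℕ) → MeasureTheory.Measure (Fin m → ℝ)
  | 0 => 0
  | k + 1 =>
    ((MeasureTheory.volume : MeasureTheory.Measure (Fin k → ℝ)).restrict
      {y | (∀ j, 0 ≤ y j) ∧ ∑ j, y j ≤ 1}).map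
        fun y => (Matrix.vecCons (1 - ∑ j, y j) y : Fin (k + 1) → ℝ)

/-- `Δ(λ) = ∏_{i < j} (λ_i - λ_j)`. -/
def vandermondeProduct {m : ℕ} (x : Fin m → ℝ) : ℝ :=
  ∏ i, ∏ j ∈ Finset.Ioi i, (x i - x j)

/-- The unnormalized measure
`δ(1 - ∑ j, λ_j) |Δ(λ)| ^ (2γ) ∏ j, λ_j ^ (α - 1) dλ_j`. -/
def eigenvalueWeight (m : ℕ) (α γ : ℝ) : MeasureTheory.Measure (Fin m → ℝ) :=
  (simplexMeasure m).withDensity fun x =>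
    ENNReal.ofReal (|vandermondeProduct x| ^ (2 * γ) * ∏ j, x j ^ (α - 1))

/-- The probability measure `ν_{α,γ}` on the simplex of spectra. -/
def eigenvalueMeasure (m : ℕ) (α γ : ℝ) : MeasureTheory.Measure (Fin m → ℝ) :=
  (eigenvalueWeight m α γ Set.univ)⁻¹ • eigenvalueWeight m α γ

/-- The average subentropy `𝓘^Q_m(α, γ) = ∫ Q(Λ) dν_{α,γ}(Λ)`. -/
def averageSubentropy (m : ℕ) (α γ : ℝ) : ℝ :=
  ∫ x, spectralSubentropy x ∂(eigenvalueMeasure m α γ)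

end

/-!
Write `η s = s * log s` and let `E₁, E₂, …` be independent standard exponential variables. Everything
rests on a probabilistic form of the subentropy, `spectralSubentropy_eq`: on the simplex

  `Q(Λ) = 1 - γ - 𝔼 η(∑ i, λ_i E_i)`.

For distinct `λ_i` the law of `∑ i, λ_i E_i` is the divided difference, at the nodes `λ_i`, of
`a ^ (m - 1)` times the law of `a E` (`HasQuadraticGrowth.integral_sum_eq`, by induction
from the case of two variables), and the right side becomes the defining formula. Since the right side is continuous on the whole simplex, it is
also the value at repeated eigenvalues. As `∑ i, λ_i E_i` has mean one, `η s ≥ s - 1` gives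
`Q ≤ 1 - γ`.

Average over `ν_{n-m+1,1}`. Multiplying a spectrum by an independent Gamma variable turns the
simplex with density `Δ² ∏ λ_j ^ (n - m)` into the Laguerre ensemble on the orthant. There the
average of the divided difference of `t ^ m * log t` reduces to a one-dimensional logarithmic moment
of Heine's integral, a polynomial orthogonal to all lower powers for the weight
`x ^ (n - m) * exp (-x)`. Orthogonality determines the Mellin transform of that polynomial up to a
constant, and its derivative at `m` produces the harmonic
numbers (`log_moment_of_orthogonal`, `integral_dividedDiff_pow_log`).

Average over random mixed states. By unitary invariance of the Gaussian distribution,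
`𝔼 η(∑ i, λ_i E_i) = 𝔼 η(⟨z, ρ z⟩)` for a standard complex Gaussian vector `z`
(`DensityMatrix.subentropy_eq`). A Gaussian `m × n` matrix `G` is a uniform pure state times
an independent radius whose square is Gamma distributed, so that `G G†` is the reduced state up to
that factor. Averaging over `G` first, `⟨z, G G† z⟩` is distributed like the product of independent
Gamma variables of parameters `m` and `n` (`map_gramForm_prod`), for which the mean of `η` is
explicit. Comparing the two evaluations gives the average.

The limit follows from `H_k - log k → γ`, and the bound `1 - γ` is the least one because the averages
with `n = m` converge to it.
-/

open MeasureTheory Set Real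

/-! ### Moments of the Gamma distribution -/

/-- The measure `x ^ a * exp (-x) dx` on `(0, ∞)`, of total mass `a!`. It is left unnormalized; for
`a = 0` it is the standard exponential distribution. -/
noncomputable def gammaWeight (a : ℕ) : Measure ℝ :=
  (volume.restrict (Ioi 0)).withDensity fun x => ENNReal.ofReal (x ^ a * exp (-x))

theorem integrable_gammaWeight_iff {a : ℕ} {g : ℝ → ℝ} :
    Integrable g (gammaWeight a) ↔ IntegrableOn (fun x => x ^ a * exp (-x) * g x) (Ioi 0) := by
  rw [gammaWeight, integrable_withDensity_iff_integrable_smul' (by fun_prop) (by simp)]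
  refine integrableOn_congr_fun (fun x hx => ?_) measurableSet_Ioi
  have hx' : (0 : ℝ) < x := hx
  simp only [smul_eq_mul]
  rw [ENNReal.toReal_ofReal (by positivity)]

theorem integral_gammaWeight (a : ℕ) (g : ℝ → ℝ) :
    ∫ x, g x ∂gammaWeight a = ∫ x in Ioi 0, x ^ a * exp (-x) * g x := by
  rw [gammaWeight, integral_withDensity_eq_integral_toReal_smul (by fun_prop) (by simp)]
  refine setIntegral_congr_fun measurableSet_Ioi (fun x hx => ?_)
  have hx' : (0 : ℝ) < x := hx
  simp only [smul_eq_mul]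
  rw [ENNReal.toReal_ofReal (by positivity)]

theorem ae_gammaWeight_pos (a : ℕ) : ∀ᵐ x ∂gammaWeight a, 0 < x :=
  (withDensity_absolutelyContinuous _ _).ae_le (ae_restrict_mem measurableSet_Ioi)

theorem integrableOn_pow_mul_exp_neg (d : ℕ) :
    IntegrableOn (fun x : ℝ => x ^ d * exp (-x)) (Ioi 0) := by
  have h := GammaIntegral_convergent (s := d + 1) (by positivity)
  refine h.congr_fun (fun x hx => ?_) measurableSet_Ioi
  simp [mul_comm]

theorem integral_pow_mul_exp_neg (d : ℕ) :
    ∫ x in Ioi (0 : ℝ), x ^ d * exp (-x) = (d.factorial : ℝ) := by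
  rw [← Gamma_nat_eq_factorial, Gamma_eq_integral (by positivity)]
  refine setIntegral_congr_fun measurableSet_Ioi (fun x hx => ?_)
  simp [mul_comm]

theorem integrable_pow_gammaWeight (a d : ℕ) : Integrable (fun x => x ^ d) (gammaWeight a) := by
  rw [integrable_gammaWeight_iff]
  refine (integrableOn_pow_mul_exp_neg (a + d)).congr_fun (fun x _ => ?_) measurableSet_Ioi
  simp only [pow_add]; ring

theorem integral_pow_gammaWeight (a d : ℕ) :
    ∫ x, x ^ d ∂gammaWeight a = ((a + d).factorial : ℝ) := by
  rw [integral_gammaWeight, ← integral_pow_mul_exp_neg]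
  refine setIntegral_congr_fun measurableSet_Ioi (fun x _ => ?_)
  simp only [pow_add]; ring

instance (a : ℕ) : IsFiniteMeasure (gammaWeight a) := by
  have h := integrable_pow_gammaWeight a 0
  simpa [integrable_const_iff] using h

theorem abs_pow_succ_mul_log_le {x : ℝ} (hx : 0 ≤ x) (d : ℕ) :
    |x ^ (d + 1) * log x| ≤ 1 + x ^ (d + 2) := by
  rcases hx.eq_or_lt with rfl | hx
  · simp
  rcases le_or_gt x 1 with h1 | h1
  · have h2 := (abs_log_mul_self_lt x hx h1).le
    have h3 : x ^ d ≤ 1 := pow_le_one₀ hx.le h1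
    calc |x ^ (d + 1) * log x| = x ^ d * |log x * x| := by
          rw [pow_succ, mul_assoc, abs_mul, abs_of_nonneg (by positivity : (0 : ℝ) ≤ x ^ d),
            mul_comm x]
      _ ≤ 1 * 1 := by gcongr
      _ ≤ 1 + x ^ (d + 2) := by have : 0 < x ^ (d + 2) := by positivity
                                linarith
  · have h2 : 0 ≤ log x := log_nonneg h1.le
    have h3 : log x ≤ x := (log_le_sub_one_of_pos hx).trans (by linarith)
    rw [abs_of_nonneg (by positivity), pow_succ x (d + 1)]
    have : x ^ (d + 1) * log x ≤ x ^ (d + 1) * x := by gcongr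
    linarith

theorem integrableOn_pow_log_mul_exp_neg (d : ℕ) :
    IntegrableOn (fun x : ℝ => x ^ (d + 1) * log x * exp (-x)) (Ioi 0) := by
  have h := (integrableOn_pow_mul_exp_neg 0).add (integrableOn_pow_mul_exp_neg (d + 2))
  refine Integrable.mono' h (by fun_prop) ?_
  filter_upwards [ae_restrict_mem measurableSet_Ioi] with x hx
  have hx' : (0 : ℝ) < x := hx
  rw [norm_mul, Real.norm_eq_abs, Real.norm_eq_abs, abs_of_pos (exp_pos _)]
  have := abs_pow_succ_mul_log_le hx'.le d
  simp only [Pi.add_apply, pow_zero, ← add_mul]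
  gcongr

/-- The derivative of the Gamma function at `d + 1`, as an integral. -/
theorem integral_pow_log_mul_exp_neg (d : ℕ) :
    ∫ x in Ioi (0 : ℝ), x ^ d * log x * exp (-x) =
      d.factorial * ((harmonic d : ℝ) - eulerMascheroniConstant) := by
  have h1 := Complex.hasDerivAt_GammaIntegral (s := (d : ℂ) + 1) (by simp; positivity)
  have h2 := Complex.hasDerivAt_Gamma_nat d
  have h3 : Complex.GammaIntegral =ᶠ[nhds ((d : ℂ) + 1)] Complex.Gamma := by
    have : ∀ᶠ s in nhds ((d : ℂ) + 1), 0 < s.re :=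
      (isOpen_lt continuous_const Complex.continuous_re).mem_nhds (by simp; positivity)
    filter_upwards [this] with s hs using (Complex.Gamma_eq_integral hs).symm
  have h4 := (h1.congr_of_eventuallyEq h3.symm).unique h2
  have h5 : ∫ (t : ℝ) in Ioi 0, (t : ℂ) ^ ((d : ℂ) + 1 - 1) * (↑(log t) * ↑(exp (-t))) =
      ((∫ x in Ioi (0 : ℝ), x ^ d * log x * exp (-x) : ℝ) : ℂ) := by
    rw [← integral_complex_ofReal]
    refine setIntegral_congr_fun measurableSet_Ioi (fun x hx => ?_)
    simp [mul_assoc]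
  rw [h5] at h4
  have h6 : (∫ x in Ioi (0 : ℝ), x ^ d * log x * exp (-x)) =
      (d.factorial : ℝ) * (-eulerMascheroniConstant + (harmonic d : ℝ)) := by
    exact_mod_cast h4
  rw [h6]; ring

theorem integrable_pow_log_gammaWeight (a d : ℕ) :
    Integrable (fun x => x ^ (d + 1) * log x) (gammaWeight a) := by
  rw [integrable_gammaWeight_iff]
  refine (integrableOn_pow_log_mul_exp_neg (a + d)).congr_fun (fun x _ => ?_) measurableSet_Ioi
  simp only [pow_add]; ring

theorem integral_pow_log_gammaWeight (a d : ℕ) :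
    ∫ x, x ^ d * log x ∂gammaWeight a =
      (a + d).factorial * ((harmonic (a + d) : ℝ) - eulerMascheroniConstant) := by
  rw [integral_gammaWeight, ← integral_pow_log_mul_exp_neg]
  refine setIntegral_congr_fun measurableSet_Ioi (fun x _ => ?_)
  simp only [pow_add]; ring

instance : IsProbabilityMeasure (gammaWeight 0) := by
  have h := integral_pow_gammaWeight 0 0
  simp only [pow_zero, integral_const, smul_eq_mul, mul_one, add_zero, Nat.factorial_zero,
    Nat.cast_one] at h
  refine ⟨?_⟩
  rw [measureReal_def] at h
  rw [← ENNReal.ofReal_toReal (measure_ne_top (gammaWeight 0) univ), h, ENNReal.ofReal_one]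

/-! ### Products of Gamma distributions and the simplex -/

/-- Products of measures with densities have the product density. -/
theorem pi_withDensity_ofReal {ι X : Type*} [Fintype ι] [MeasurableSpace X] (μ : Measure X)
    [SigmaFinite μ] {f : X → ℝ} (hf : Integrable f μ) (h0 : 0 ≤ᵐ[μ] f) :
    Measure.pi (fun _ : ι => μ.withDensity fun x => ENNReal.ofReal (f x)) =
      (Measure.pi fun _ : ι => μ).withDensity fun x => ENNReal.ofReal (∏ i, f (x i)) := by
  have : IsFiniteMeasure (μ.withDensity fun x => ENNReal.ofReal (f x)) :=
    isFiniteMeasure_withDensity_ofReal hf.2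
  refine Measure.pi_eq fun s hs => ?_
  rw [withDensity_apply _ (MeasurableSet.univ_pi hs), Measure.restrict_pi_pi]
  have hfs : ∀ i, Integrable f (μ.restrict (s i)) := fun i => hf.restrict
  have h0s : ∀ i, 0 ≤ᵐ[μ.restrict (s i)] f := fun i => ae_restrict_of_ae h0
  rw [← ofReal_integral_eq_lintegral_ofReal (Integrable.fintype_prod (fun i => hfs i)),
    integral_fintype_prod_eq_prod, ENNReal.ofReal_prod_of_nonneg]
  · refine Finset.prod_congr rfl fun i _ => ?_
    rw [withDensity_apply _ (hs i), ofReal_integral_eq_lintegral_ofReal (hfs i) (h0s i)]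
  · exact fun i _ => integral_nonneg_of_ae (h0s i)
  · have : ∀ i, ∀ᵐ x ∂Measure.pi fun i => μ.restrict (s i), 0 ≤ f (x i) := fun i =>
      (Measure.tendsto_eval_ae_ae (μ := fun i => μ.restrict (s i)) (i := i)).eventually (h0s i)
    filter_upwards [ae_all_iff.2 this] with x hx using Finset.prod_nonneg fun i _ => hx i

theorem gammaWeight_eq_withDensity (a : ℕ) :
    gammaWeight a = (gammaWeight 0).withDensity fun x => ENNReal.ofReal (x ^ a) := by
  rw [gammaWeight, gammaWeight, ← withDensity_mul _ (by fun_prop) (by fun_prop)]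
  refine withDensity_congr_ae ?_
  filter_upwards [ae_restrict_mem measurableSet_Ioi] with x hx
  have hx' : (0 : ℝ) < x := hx
  simp only [Pi.mul_apply]
  rw [← ENNReal.ofReal_mul (by positivity)]
  congr 1; ring

theorem pi_gammaWeight_eq_withDensity {ι : Type*} [Fintype ι] (a : ℕ) :
    Measure.pi (fun _ : ι => gammaWeight a) = (Measure.pi fun _ : ι => gammaWeight 0).withDensity
      fun x => ENNReal.ofReal (∏ i, x i ^ a) := by
  rw [← pi_withDensity_ofReal _ (integrable_pow_gammaWeight 0 a), ← gammaWeight_eq_withDensity]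
  filter_upwards [ae_gammaWeight_pos 0] with x hx
  simp only [Pi.zero_apply]; positivity

theorem ae_pi_gammaWeight_pos {ι : Type*} [Fintype ι] (a : ℕ) :
    ∀ᵐ x ∂Measure.pi (fun _ : ι => gammaWeight a), ∀ i, 0 < x i :=
  ae_all_iff.2 fun _ => Measure.tendsto_eval_ae_ae.eventually (ae_gammaWeight_pos a)

theorem pi_gammaWeight_zero_eq {ι : Type*} [Fintype ι] :
    Measure.pi (fun _ : ι => gammaWeight 0) =
      ((volume : Measure (ι → ℝ)).restrict (univ.pi fun _ => Ioi 0)).withDensity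
        fun x => ENNReal.ofReal (exp (-∑ i, x i)) := by
  simp only [gammaWeight, pow_zero, one_mul]
  rw [pi_withDensity_ofReal]
  · simp only [← exp_sum, Finset.sum_neg_distrib]
    rw [volume_pi, Measure.restrict_pi_pi]
  · simpa [IntegrableOn] using integrableOn_pow_mul_exp_neg 0
  · exact Filter.Eventually.of_forall fun x => (exp_pos _).le

theorem measurableSet_corner (k : ℕ) :
    MeasurableSet {y : Fin k → ℝ | (∀ j, 0 ≤ y j) ∧ ∑ j, y j ≤ 1} := by
  refine IsClosed.measurableSet (IsClosed.inter ?_ (isClosed_le (f := fun y : Fin k → ℝ => ∑ j, y j)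
    (by fun_prop) continuous_const))
  exact isClosed_le (f := fun _ => (0 : Fin k → ℝ)) continuous_const continuous_id

theorem measurable_vecCons_one_sub_sum (k : ℕ) :
    Measurable fun y : Fin k → ℝ => (Matrix.vecCons (1 - ∑ j, y j) y : Fin (k + 1) → ℝ) := by
  refine measurable_pi_iff.2 fun i => ?_
  refine Fin.cases ?_ (fun j => ?_) i
  · simp only [Matrix.cons_val_zero]; fun_prop
  · simp only [Matrix.cons_val_succ]; fun_prop

/-- Lebesgue measure on the positive orthant disintegrates over the scale `r = ∑ i, x i`. -/
theorem lintegral_orthant (k : ℕ) {F : (Fin (k + 1) → ℝ) → ENNReal} (hF : Measurable F) :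
    ∫⁻ x in {x | ∀ i, 0 ≤ x i}, F x =
      ∫⁻ r in Ioi (0 : ℝ), ENNReal.ofReal (r ^ k) * ∫⁻ l, F (r • l) ∂simplexMeasure (k + 1) := by
  have hS : MeasurableSet {x : Fin (k + 1) → ℝ | ∀ i, 0 ≤ x i} :=
    (isClosed_le (f := fun _ => (0 : Fin (k + 1) → ℝ)) continuous_const continuous_id).measurableSet
  have hT := measurableSet_corner k
  have hcons := measurable_vecCons_one_sub_sum k
  set G : (Fin (k + 1) → ℝ) → ENNReal := {x | ∀ i, 0 ≤ x i}.indicator F with hG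
  have hGm : Measurable G := hF.indicator hS
  have hc2 : Measurable fun p : ℝ × (Fin k → ℝ) => (Fin.cons p.1 p.2 : Fin (k + 1) → ℝ) := by
    refine measurable_pi_iff.2 fun i => ?_
    refine Fin.cases ?_ (fun j => ?_) i
    · simp only [Fin.cons_zero]; fun_prop
    · simp only [Fin.cons_succ]; fun_prop
  rw [← lintegral_indicator hS]
  have h1 := (volume_preserving_piFinSuccAbove (fun _ : Fin (k + 1) => ℝ) 0).symm.lintegral_comp
    hGm
  rw [← hG, ← h1]
  have h2 : ∀ p : ℝ × (Fin k → ℝ),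
      (MeasurableEquiv.piFinSuccAbove (fun _ : Fin (k + 1) => ℝ) 0).symm p = Fin.cons p.1 p.2 := by
    intro p
    simp [MeasurableEquiv.piFinSuccAbove, Fin.consEquiv]
  simp only [h2]
  rw [Measure.volume_eq_prod, lintegral_prod_symm
    (fun p : ℝ × (Fin k → ℝ) => G (Fin.cons p.1 p.2)) (hGm.comp hc2).aemeasurable]
  -- the first coordinate is traded for the sum `r` of all coordinates
  have h3 : ∀ y : Fin k → ℝ, ∫⁻ x : ℝ, G (Fin.cons x y) =
      ∫⁻ r : ℝ, G (Fin.cons (r - ∑ j, y j) y) := fun y =>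
    (lintegral_sub_right_eq_self (fun x => G (Fin.cons x y)) (∑ j, y j)).symm
  simp only [h3]
  have hm : Measurable fun p : (Fin k → ℝ) × ℝ => G (Fin.cons (p.2 - ∑ j, p.1 j) p.1) :=
    hGm.comp (hc2.comp (f := fun p : (Fin k → ℝ) × ℝ => (p.2 - ∑ j, p.1 j, p.1)) (by fun_prop))
  rw [lintegral_lintegral_swap hm.aemeasurable]
  have h4 : ∀ r : ℝ, r < 0 → ∫⁻ y : Fin k → ℝ, G (Fin.cons (r - ∑ j, y j) y) = 0 := by
    intro r hr
    rw [← lintegral_zero (μ := (volume : Measure (Fin k → ℝ)))]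
    refine lintegral_congr fun y => ?_
    refine indicator_of_notMem (fun h => ?_) _
    have h0 := h 0
    have hs : ∀ j, 0 ≤ y j := fun j => by simpa using h j.succ
    have := Finset.sum_nonneg fun j (_ : j ∈ Finset.univ) => hs j
    simp only [Fin.cons_zero] at h0
    linarith
  rw [← lintegral_add_compl _ (measurableSet_Ioi (a := (0 : ℝ)))]
  have h5 : ∫⁻ r in (Ioi (0 : ℝ))ᶜ, ∫⁻ y : Fin k → ℝ, G (Fin.cons (r - ∑ j, y j) y) = 0 := by
    rw [compl_Ioi, ← restrict_Iio_eq_restrict_Iic]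
    exact (setLIntegral_congr_fun measurableSet_Iio fun r hr => h4 r hr).trans (by simp)
  rw [h5, add_zero]
  refine setLIntegral_congr_fun measurableSet_Ioi fun r hr => ?_
  have hr' : (0 : ℝ) < r := hr
  have hsm := Measure.map_addHaar_smul (volume : Measure (Fin k → ℝ)) hr'.ne'
  -- the other coordinates are rescaled by `r`
  have h6 : ∀ h : (Fin k → ℝ) → ENNReal, Measurable h →
      ∫⁻ y, h y = ENNReal.ofReal (r ^ k) * ∫⁻ y, h (r • y) := by
    intro h hh
    have : ∫⁻ y, h (r • y) = ENNReal.ofReal |(r ^ k)⁻¹| * ∫⁻ y, h y := by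
      rw [← lintegral_map hh (measurable_const_smul r), hsm, lintegral_smul_measure]
      simp
    rw [this, ← mul_assoc, ← ENNReal.ofReal_mul (by positivity),
      abs_of_pos (by positivity), mul_inv_cancel₀ (by positivity)]
    simp
  rw [h6 (fun y => G (Fin.cons (r - ∑ j, y j) y))
    (hm.comp (by fun_prop : Measurable fun y : Fin k → ℝ => (y, r))), simplexMeasure,
    lintegral_map (f := fun l => F (r • l)) (hF.comp (measurable_const_smul r)) hcons, ← lintegral_indicator hT]
  congr 1
  refine lintegral_congr fun y => ?_
  have h7 : (Fin.cons (r - ∑ j, (r • y) j) (r • y) : Fin (k + 1) → ℝ) =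
      r • Matrix.vecCons (1 - ∑ j, y j) y := by
    ext i
    refine Fin.cases ?_ (fun j => ?_) i
    · simp [← Finset.mul_sum, mul_sub]
    · simp
  simp only [h7, hG, indicator_apply, mem_ofPred_eq]
  congr 1
  rw [Fin.forall_fin_succ]
  simp only [Pi.smul_apply, smul_eq_mul, Matrix.cons_val_zero, Matrix.cons_val_succ,
    mul_nonneg_iff_of_pos_left hr', sub_nonneg]
  exact propext and_comm

instance isFiniteMeasure_simplexMeasure (m : ℕ) : IsFiniteMeasure (simplexMeasure m) := by
  cases m with
  | zero => rw [simplexMeasure]; infer_instance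
  | succ k =>
    rw [simplexMeasure]
    have : IsFiniteMeasure ((volume : Measure (Fin k → ℝ)).restrict
        {y | (∀ j, 0 ≤ y j) ∧ ∑ j, y j ≤ 1}) := by
      refine isFiniteMeasure_restrict.2 (ne_top_of_le_ne_top ?_ (measure_mono (t := Icc 0 1) ?_))
      · exact (isCompact_Icc.measure_lt_top).ne
      · intro y hy
        refine ⟨hy.1, fun j => ?_⟩
        exact (Finset.single_le_sum (fun i _ => hy.1 i) (Finset.mem_univ j)).trans hy.2
    infer_instance

theorem ae_simplexMeasure_mem (m : ℕ) : ∀ᵐ x ∂simplexMeasure m, x ∈ stdSimplex ℝ (Fin m) := by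
  cases m with
  | zero => simp [simplexMeasure]
  | succ k =>
    rw [simplexMeasure]
    refine (ae_map_iff (measurable_vecCons_one_sub_sum k).aemeasurable
      (isClosed_stdSimplex ℝ (Fin (k + 1))).measurableSet).2 ?_
    filter_upwards [ae_restrict_mem (measurableSet_corner k)] with y hy
    refine ⟨fun i => ?_, ?_⟩
    · refine Fin.cases ?_ (fun j => ?_) i
      · simpa using hy.2
      · simpa using hy.1 j
    · rw [Fin.sum_univ_succ]; simp

/-- Independent exponential variables are the product of their sum, which is Gamma distributed,
and an independent uniform probability vector. Neither factor on the right is normalized: their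
masses `k!` and `1 / k!` cancel. -/
theorem pi_gammaWeight_zero_eq_map (k : ℕ) :
    Measure.pi (fun _ : Fin (k + 1) => gammaWeight 0) =
      ((gammaWeight k).prod (simplexMeasure (k + 1))).map fun p => p.1 • p.2 := by
  have hsmul : Measurable fun p : ℝ × (Fin (k + 1) → ℝ) => p.1 • p.2 := by fun_prop
  refine Measure.ext_of_lintegral _ fun F hF => ?_
  rw [lintegral_map hF hsmul, lintegral_prod
    (fun p : ℝ × (Fin (k + 1) → ℝ) => F (p.1 • p.2)) (hF.comp hsmul).aemeasurable,
    pi_gammaWeight_zero_eq, lintegral_withDensity_eq_lintegral_mul _ (by fun_prop) hF,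
    volume_pi, Measure.restrict_pi_pi]
  have h1 : (Measure.pi fun _ : Fin (k + 1) => (volume : Measure ℝ).restrict (Ioi 0)) =
      (volume : Measure (Fin (k + 1) → ℝ)).restrict {x | ∀ i, 0 ≤ x i} := by
    have : {x : Fin (k + 1) → ℝ | ∀ i, 0 ≤ x i} = univ.pi fun _ => Ici 0 := by
      ext; simp [Pi.le_def]
    rw [this, volume_pi, Measure.restrict_pi_pi]
    simp only [restrict_Ioi_eq_restrict_Ici]
  rw [h1, lintegral_orthant _ (by fun_prop), gammaWeight,
    lintegral_withDensity_eq_lintegral_mul _ (by fun_prop)]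
  · refine setLIntegral_congr_fun measurableSet_Ioi fun r hr => ?_
    have hr' : (0 : ℝ) < r := hr
    simp only [Pi.mul_apply]
    rw [ENNReal.ofReal_mul (by positivity), mul_assoc]
    congr 1
    rw [← lintegral_const_mul (μ := simplexMeasure (k + 1)) (f := fun l => F (r • l)) _
      (hF.comp (measurable_const_smul r))]
    refine lintegral_congr_ae ?_
    filter_upwards [ae_simplexMeasure_mem (k + 1)] with l hl
    simp only [Pi.smul_apply, smul_eq_mul, ← Finset.mul_sum, hl.2, mul_one]
  · exact Measurable.lintegral_prod_right' (hF.comp hsmul)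

/-- Polynomials, multiplied by functions of the coordinates all of whose moments exist, are
integrable for a product measure. -/
theorem integrable_pi_prod_mul_mvPolynomial {ι : Type*} [Fintype ι] {μ : Measure ℝ}
    [SigmaFinite μ] {g : ι → ℝ → ℝ} (hg : ∀ i (e : ℕ), Integrable (fun x => g i x * x ^ e) μ)
    (p : MvPolynomial ι ℝ) :
    Integrable (fun x => (∏ i, g i (x i)) * MvPolynomial.eval x p)
      (Measure.pi fun _ : ι => μ) := by
  induction p using MvPolynomial.induction_on' with
  | monomial u a =>
    have h : Integrable (fun x : ι → ℝ => ∏ j, (g j (x j) * x j ^ u j))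
        (Measure.pi fun _ : ι => μ) :=
      Integrable.fintype_prod (f := fun j (t : ℝ) => g j t * t ^ u j) fun j => hg j _
    refine (h.const_mul a).congr (Filter.Eventually.of_forall fun x => ?_)
    simp only [MvPolynomial.eval_monomial, Finsupp.prod_fintype _ _ fun _ => pow_zero _,
      Finset.prod_mul_distrib]
    ring
  | add p q hp hq =>
    simp only [map_add, mul_add]
    exact hp.add hq

theorem integrable_pi_mvPolynomial {ι : Type*} [Fintype ι] {μ : Measure ℝ} [SigmaFinite μ]
    (hμ : ∀ e : ℕ, Integrable (fun x => x ^ e) μ) (p : MvPolynomial ι ℝ) :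
    Integrable (fun x => MvPolynomial.eval x p) (Measure.pi fun _ : ι => μ) := by
  simpa using integrable_pi_prod_mul_mvPolynomial (g := fun _ _ => 1) (fun _ e => by simpa using hμ e) p

theorem integrable_pi_mul_mvPolynomial {ι : Type*} [Fintype ι] [DecidableEq ι] {μ : Measure ℝ}
    [SigmaFinite μ] (hμ : ∀ e : ℕ, Integrable (fun x => x ^ e) μ) {g : ℝ → ℝ}
    (hg : ∀ e : ℕ, Integrable (fun x => g x * x ^ e) μ) (i : ι) (p : MvPolynomial ι ℝ) :
    Integrable (fun x => g (x i) * MvPolynomial.eval x p) (Measure.pi fun _ : ι => μ) := by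
  have h := integrable_pi_prod_mul_mvPolynomial (μ := μ)
    (g := fun j t => if j = i then g t else 1) (fun j e => ?_) p
  · simpa [Finset.prod_ite_eq'] using h
  · split_ifs
    · exact hg e
    · simpa using hμ e

/-! ### Linear combinations of exponential variables -/

/-- Continuous functions of at most quadratic growth, the class of test functions for the law of
a linear combination of exponential variables. -/
def HasQuadraticGrowth (φ : ℝ → ℝ) : Prop :=
  Continuous φ ∧ ∃ C, ∀ s, |φ s| ≤ C * (1 + |s|) ^ 2

/-- The average of `φ (s + a E)` for a standard exponential variable `E`. -/
noncomputable def expAverage (a : ℝ) (φ : ℝ → ℝ) (s : ℝ) : ℝ :=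
  ∫ x, φ (s + a * x) ∂gammaWeight 0

theorem one_add_abs_add_le (s t : ℝ) : 1 + |s + t| ≤ (1 + |s|) * (1 + |t|) := by
  nlinarith [abs_add_le s t, mul_nonneg (abs_nonneg s) (abs_nonneg t)]

theorem one_add_abs_add_sum_le {ι : Type*} (t : Finset ι) (s : ℝ) (f : ι → ℝ) :
    1 + |s + ∑ i ∈ t, f i| ≤ (1 + |s|) * ∏ i ∈ t, (1 + |f i|) := by
  classical
  induction t using Finset.induction_on with
  | empty => simp
  | insert i t hi ih =>
    rw [Finset.sum_insert hi, Finset.prod_insert hi]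
    calc 1 + |s + (f i + ∑ i ∈ t, f i)| = 1 + |f i + (s + ∑ i ∈ t, f i)| := by ring_nf
      _ ≤ (1 + |f i|) * (1 + |s + ∑ i ∈ t, f i|) := one_add_abs_add_le _ _
      _ ≤ (1 + |f i|) * ((1 + |s|) * ∏ i ∈ t, (1 + |f i|)) := by gcongr
      _ = _ := by ring

theorem integrable_one_add_abs_pow (a : ℝ) (d n : ℕ) :
    Integrable (fun x => (1 + |a * x|) ^ n) (gammaWeight d) := by
  have h : Integrable (fun x => ∑ i ∈ Finset.range (n + 1), (|a| ^ i * n.choose i) * x ^ i)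
      (gammaWeight d) :=
    integrable_finsetSum _ fun i _ => (integrable_pow_gammaWeight d i).const_mul _
  refine h.congr ?_
  filter_upwards [ae_gammaWeight_pos d] with x hx
  rw [add_comm 1, add_pow, abs_mul, abs_of_pos hx]
  refine Finset.sum_congr rfl fun i _ => ?_
  rw [mul_pow]; ring

namespace HasQuadraticGrowth

variable {φ : ℝ → ℝ}

theorem bound_nonneg {C : ℝ} (h : ∀ s, |φ s| ≤ C * (1 + |s|) ^ 2) : 0 ≤ C := by
  have := (abs_nonneg _).trans (h 0)
  simpa using this

theorem integrable_sum {ι : Type*} [Fintype ι] (hφ : HasQuadraticGrowth φ) (x : ι → ℝ) (s : ℝ) :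
    Integrable (fun y : ι → ℝ => φ (s + ∑ i, x i * y i))
      (Measure.pi fun _ : ι => gammaWeight 0) := by
  obtain ⟨hc, C, hC⟩ := hφ
  have h : Integrable (fun y : ι → ℝ => ∏ i, (1 + |x i * y i|) ^ 2)
      (Measure.pi fun _ : ι => gammaWeight 0) :=
    Integrable.fintype_prod (f := fun i t => (1 + |x i * t|) ^ 2)
      fun i => integrable_one_add_abs_pow (x i) 0 2
  refine (h.const_mul (C * (1 + |s|) ^ 2)).mono'
    (hc.comp (by fun_prop)).aestronglyMeasurable (Filter.Eventually.of_forall ?_)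
  intro y
  refine (hC _).trans ?_
  rw [mul_assoc, Finset.prod_pow, ← mul_pow]
  have := bound_nonneg hC
  gcongr
  exact one_add_abs_add_sum_le _ _ _

theorem integrable (hφ : HasQuadraticGrowth φ) (a s : ℝ) :
    Integrable (fun x => φ (s + a * x)) (gammaWeight 0) := by
  obtain ⟨hc, C, hC⟩ := hφ
  refine ((integrable_one_add_abs_pow a 0 2).const_mul (C * (1 + |s|) ^ 2)).mono'
    (by fun_prop) (Filter.Eventually.of_forall ?_)
  intro y
  refine (hC _).trans ?_
  rw [mul_assoc, ← mul_pow]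
  have := bound_nonneg hC
  gcongr
  exact one_add_abs_add_le _ _

protected theorem expAverage (hφ : HasQuadraticGrowth φ) (a : ℝ) :
    HasQuadraticGrowth (expAverage a φ) := by
  have hφ' := hφ
  obtain ⟨hc, C, hC⟩ := hφ'
  have hC0 := bound_nonneg hC
  have hb : ∀ s x, |φ (s + a * x)| ≤ C * (1 + |s|) ^ 2 * (1 + |a * x|) ^ 2 := by
    intro s x
    refine (hC _).trans ?_
    rw [mul_assoc, ← mul_pow]
    gcongr
    exact one_add_abs_add_le _ _
  constructor
  · refine continuous_iff_continuousAt.2 fun s₀ => ?_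
    refine continuousAt_of_dominated
      (bound := fun x => C * (1 + (|s₀| + 1)) ^ 2 * (1 + |a * x|) ^ 2) ?_ ?_ ?_ ?_
    · exact Filter.Eventually.of_forall fun s => by fun_prop
    · filter_upwards [Metric.ball_mem_nhds s₀ one_pos] with s hs
      have hs' : |s| ≤ |s₀| + 1 := by
        have h1 : |s - s₀| < 1 := by simpa [dist_eq] using hs
        have := abs_sub_abs_le_abs_sub s s₀
        linarith
      refine Filter.Eventually.of_forall fun x => (hb s x).trans ?_
      gcongr
    · exact (integrable_one_add_abs_pow a 0 2).const_mul _
    · exact Filter.Eventually.of_forall fun x => by fun_prop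
  · refine ⟨C * ∫ x, (1 + |a * x|) ^ 2 ∂gammaWeight 0, fun s => ?_⟩
    calc |∫ x, φ (s + a * x) ∂gammaWeight 0| ≤ ∫ x, |φ (s + a * x)| ∂gammaWeight 0 :=
          abs_integral_le_integral_abs
      _ ≤ ∫ x, C * (1 + |s|) ^ 2 * (1 + |a * x|) ^ 2 ∂gammaWeight 0 :=
          integral_mono (hφ.integrable a s).abs
            ((integrable_one_add_abs_pow a 0 2).const_mul _) (hb s)
      _ = _ := by rw [integral_const_mul]; ring

/-- Averaging over the first variable replaces `φ` by `expAverage (x 0) φ`, which is again a test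
function; this drives the inductions over the number of variables. -/
theorem integral_sum_succ (hφ : HasQuadraticGrowth φ) {n : ℕ} (x : Fin (n + 1) → ℝ) (s : ℝ) :
    ∫ y, φ (s + ∑ i, x i * y i) ∂(Measure.pi fun _ : Fin (n + 1) => gammaWeight 0) =
      ∫ y, expAverage (x 0) φ (s + ∑ i : Fin n, x i.succ * y i)
        ∂(Measure.pi fun _ : Fin n => gammaWeight 0) := by
  have hmp := (measurePreserving_piFinSuccAbove (fun _ : Fin (n + 1) => gammaWeight 0) 0).symm
  have hi := hφ.integrable_sum x s
  rw [← hmp.integral_comp' (g := fun y => φ (s + ∑ i, x i * y i))]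
  have hi2 := (hmp.integrable_comp_emb (MeasurableEquiv.measurableEmbedding _)).2 hi
  have h2 : ∀ p : ℝ × (Fin n → ℝ),
      (MeasurableEquiv.piFinSuccAbove (fun _ : Fin (n + 1) => ℝ) 0).symm p = Fin.cons p.1 p.2 := by
    intro p
    simp [MeasurableEquiv.piFinSuccAbove, Fin.consEquiv]
  simp only [Function.comp_def, h2, Fin.sum_univ_succ, Fin.cons_zero, Fin.cons_succ] at hi2 ⊢
  rw [integral_prod_symm _ hi2]
  refine integral_congr_ae (Filter.Eventually.of_forall fun y => ?_)
  simp only [expAverage]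
  refine integral_congr_ae (Filter.Eventually.of_forall fun t => ?_)
  simp only
  congr 1; ring

/-- The average of a primitive of `φ`, by integration by parts against `exp (-u)`. This removes the
factors `a` and `b` from the difference quotient in `expAverage_expAverage`. -/
theorem mul_expAverage_eq (hφ : HasQuadraticGrowth φ) (b s : ℝ) :
    Integrable (fun u => ∫ t in s..s + b * u, φ t) (gammaWeight 0) ∧
    b * expAverage b φ s = ∫ u, (∫ t in s..s + b * u, φ t) ∂gammaWeight 0 := by
  have hint := hφ.integrable b s
  obtain ⟨hc, C, hC⟩ := hφ
  have hC0 := bound_nonneg hC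
  have hd : ∀ u, HasDerivAt (fun u => ∫ t in s..s + b * u, φ t) (b * φ (s + b * u)) u := by
    intro u
    have h1 := (hc.integral_hasStrictDerivAt s (s + b * u)).hasDerivAt
    have h2 : HasDerivAt (fun u => s + b * u) b u := by
      simpa using ((hasDerivAt_id u).const_mul b).const_add s
    have := h1.comp u h2
    rwa [mul_comm] at this
  have hcont : Continuous fun u => ∫ t in s..s + b * u, φ t :=
    continuous_iff_continuousAt.2 fun u => (hd u).continuousAt
  have hI : Integrable (fun u => ∫ t in s..s + b * u, φ t) (gammaWeight 0) := by
    refine ((integrable_one_add_abs_pow b 0 3).const_mul (C * (1 + |s|) ^ 2)).mono'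
      (by fun_prop) (Filter.Eventually.of_forall fun u => ?_)
    have h1 : ‖∫ t in s..s + b * u, φ t‖ ≤
        (C * ((1 + |s|) * (1 + |b * u|)) ^ 2) * |s + b * u - s| := by
      refine intervalIntegral.norm_integral_le_of_norm_le_const fun t ht => ?_
      refine (hC t).trans ?_
      have h2 : |t - s| ≤ |b * u| := by
        have := abs_sub_left_of_mem_uIcc (uIoc_subset_uIcc ht)
        simpa using this
      have h3 := one_add_abs_add_le s (t - s)
      rw [add_sub_cancel] at h3
      gcongr
      refine h3.trans ?_
      gcongr
    refine h1.trans ?_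
    rw [add_sub_cancel_left, mul_pow]
    have : (1 + |b * u|) ^ 2 * |b * u| ≤ (1 + |b * u|) ^ 3 := by
      rw [pow_succ _ 2]; gcongr; linarith
    calc C * ((1 + |s|) ^ 2 * (1 + |b * u|) ^ 2) * |b * u| =
        C * (1 + |s|) ^ 2 * ((1 + |b * u|) ^ 2 * |b * u|) := by ring
      _ ≤ _ := by gcongr
  refine ⟨hI, ?_⟩
  have hd2 : ∀ u, HasDerivAt (fun u => exp (-u) * ∫ t in s..s + b * u, φ t)
      (b * (exp (-u) * φ (s + b * u)) - exp (-u) * ∫ t in s..s + b * u, φ t) u := by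
    intro u
    have h1 : HasDerivAt (fun u => exp (-u)) (-exp (-u)) u := by
      simpa using (hasDerivAt_neg u).exp
    exact (h1.mul (hd u)).congr_deriv (by ring)
  have i1 : IntegrableOn (fun u => exp (-u) * φ (s + b * u)) (Ioi 0) := by
    simpa using integrable_gammaWeight_iff.1 hint
  have i2 : IntegrableOn (fun u => exp (-u) * ∫ t in s..s + b * u, φ t) (Ioi 0) := by
    simpa using integrable_gammaWeight_iff.1 hI
  have i3 := (i1.const_mul b).sub i2
  have hlim := tendsto_zero_of_hasDerivAt_of_integrableOn_Ioi (fun u _ => hd2 u) i3 i2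
  have h := integral_Ioi_of_hasDerivAt_of_tendsto' (fun u _ => hd2 u) i3 hlim
  rw [integral_sub (i1.const_mul b) i2, integral_const_mul] at h
  rw [expAverage, integral_gammaWeight, integral_gammaWeight]
  simp only [pow_zero, one_mul]
  simp at h
  linarith

/-- The law of `a E₁ + b E₂` for independent exponential variables is a difference quotient of the
laws of `a E₁` and `b E₂`. -/
theorem expAverage_expAverage (hφ : HasQuadraticGrowth φ) {a b : ℝ} (hab : a ≠ b) (s : ℝ) :
    expAverage a (expAverage b φ) s =
      (a * expAverage a φ s - b * expAverage b φ s) / (a - b) := by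
  have hab' : a - b ≠ 0 := sub_ne_zero.2 hab
  obtain ⟨ia, ea⟩ := hφ.mul_expAverage_eq a s
  obtain ⟨ib, eb⟩ := hφ.mul_expAverage_eq b s
  rw [ea, eb, ← integral_sub ia ib, eq_div_iff hab']
  have h1 : ∫ y, φ (s + ∑ i, ![b, a] i * y i) ∂(Measure.pi fun _ : Fin 2 => gammaWeight 0) =
      expAverage a (expAverage b φ) s :=
    (hφ.integral_sum_succ (n := 1) ![b, a] s).trans
      (((hφ.expAverage b).integral_sum_succ (n := 0) ![a] s).trans (by simp))
  -- given `E₁ + E₂ = u`, the sum `b * E₁ + a * E₂` is uniform on the segment from `b * u` to `a * u`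
  rw [← h1, pi_gammaWeight_zero_eq_map]
  have hsmul : Measurable fun p : ℝ × (Fin 2 → ℝ) => p.1 • p.2 := by fun_prop
  have hcf : Continuous fun y : Fin 2 → ℝ => φ (s + ∑ i, ![b, a] i * y i) :=
    hφ.1.comp (by fun_prop)
  have hi := hφ.integrable_sum ![b, a] s
  rw [pi_gammaWeight_zero_eq_map] at hi
  replace hi := (integrable_map_measure hcf.aestronglyMeasurable hsmul.aemeasurable).1 hi
  rw [integral_map hsmul.aemeasurable hcf.aestronglyMeasurable]
  simp only [Function.comp_def, Fin.sum_univ_two, Fin.isValue, Matrix.cons_val_zero,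
    Matrix.cons_val_one, Matrix.cons_val_fin_one, Pi.smul_apply, smul_eq_mul] at hi ⊢
  rw [integral_prod _ hi, integral_gammaWeight, integral_gammaWeight, ← integral_mul_const]
  refine setIntegral_congr_fun measurableSet_Ioi fun u hu => ?_
  have hc := hφ.1
  simp only [pow_one, pow_zero, one_mul]
  have h3 : ∫ y, φ (s + (b * (u * y 0) + a * (u * y 1))) ∂simplexMeasure (1 + 1) =
      ∫ t in (0 : ℝ)..1, φ (s + b * u + (a - b) * u * t) := by
    rw [simplexMeasure, integral_map (measurable_vecCons_one_sub_sum 1).aemeasurable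
      (Continuous.aestronglyMeasurable (by fun_prop)),
      intervalIntegral.integral_of_le zero_le_one, ← integral_Icc_eq_integral_Ioc]
    have hmp := volume_preserving_funUnique (Fin 1) ℝ
    rw [← hmp.setIntegral_preimage_emb (MeasurableEquiv.measurableEmbedding _)]
    have hset : (MeasurableEquiv.funUnique (Fin 1) ℝ) ⁻¹' Icc 0 1 =
        {y | (∀ j, 0 ≤ y j) ∧ ∑ j, y j ≤ 1} := by
      ext y; simp [MeasurableEquiv.funUnique]
    rw [hset]
    refine integral_congr_ae (Filter.Eventually.of_forall fun y => ?_)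
    simp [MeasurableEquiv.funUnique]
    congr 1; ring
  have h4 : (a - b) * u * ∫ t in (0 : ℝ)..1, φ (s + b * u + (a - b) * u * t) =
      ∫ t in s + b * u..s + a * u, φ t := by
    have := intervalIntegral.smul_integral_comp_add_mul (a := 0) (b := 1) φ ((a - b) * u)
      (s + b * u)
    rw [smul_eq_mul] at this
    rw [this]
    congr 1 <;> ring
  rw [h3, intervalIntegral.integral_interval_sub_left (hc.intervalIntegrable _ _)
    (hc.intervalIntegrable _ _), ← h4]
  ring

end HasQuadraticGrowth

/-! ### Divided differences and the subentropy -/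

/-- The divided difference `∑ i, g (x i) / ∏ j ≠ i, (x i - x j)` of `g` at the nodes `x`. -/
noncomputable def dividedDiff (g : ℝ → ℝ) {n : ℕ} (x : Fin n → ℝ) : ℝ :=
  ∑ i, g (x i) / ∏ j ∈ Finset.univ.erase i, (x i - x j)

theorem subentropyFormula_eq {m : ℕ} (x : Fin m → ℝ) :
    subentropyFormula x = -dividedDiff (fun t => t ^ m * log t) x := by
  simp only [subentropyFormula, dividedDiff]
  congr 1
  exact Finset.sum_congr rfl fun i _ => by ring

theorem dividedDiff_pow_of_lt {n r : ℕ} (hr : r + 1 < n) {x : Fin n → ℝ}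
    (hx : Function.Injective x) : dividedDiff (fun t => t ^ r) x = 0 := by
  have h := Lagrange.coeff_eq_sum (s := Finset.univ) (v := x) hx.injOn
    (P := (Polynomial.X ^ r : Polynomial ℝ))
    (by rw [Polynomial.degree_X_pow, Finset.card_univ, Fintype.card_fin]; exact_mod_cast by omega)
  simp only [Finset.card_univ, Fintype.card_fin, Polynomial.eval_pow, Polynomial.eval_X,
    Polynomial.coeff_X_pow] at h
  rw [if_neg (by omega)] at h
  exact h.symm

theorem dividedDiff_pow_self {n : ℕ} {x : Fin (n + 1) → ℝ}
    (hx : Function.Injective x) : dividedDiff (fun t => t ^ n) x = 1 := by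
  have h := Lagrange.coeff_eq_sum (s := Finset.univ) (v := x) hx.injOn
    (P := (Polynomial.X ^ n : Polynomial ℝ))
    (by rw [Polynomial.degree_X_pow, Finset.card_univ, Fintype.card_fin]; exact_mod_cast by omega)
  simp only [Finset.card_univ, Fintype.card_fin, Polynomial.eval_pow, Polynomial.eval_X,
    Polynomial.coeff_X_pow] at h
  rw [if_pos (by omega)] at h
  exact h.symm

theorem prod_univ_erase_eq {n : ℕ} (f : Fin (n + 1) → ℝ) (i : Fin (n + 1)) :
    ∏ j ∈ Finset.univ.erase i, f j = ∏ j : Fin n, f (i.succAbove j) := by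
  rw [Fin.univ_succAbove n i, Finset.erase_cons, Finset.prod_map]
  rfl

theorem prod_univ_erase_succ {n : ℕ} (f : Fin (n + 1) → ℝ) (i : Fin n) :
    ∏ j ∈ Finset.univ.erase i.succ, f j = f 0 * ∏ j ∈ Finset.univ.erase i, f j.succ := by
  have h : Finset.univ.erase i.succ =
      Finset.cons 0 ((Finset.univ.erase i).map (Fin.succEmb n)) (by simp) := by
    ext j
    refine Fin.cases ?_ (fun j => ?_) j
    · simp [(Fin.succ_ne_zero i).symm]
    · simp
  rw [h, Finset.prod_cons, Finset.prod_map]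
  rfl

theorem dividedDiff_succ (g : ℝ → ℝ) {n : ℕ} (x : Fin (n + 1) → ℝ) :
    dividedDiff g x = g (x 0) / ∏ j : Fin n, (x 0 - x j.succ) +
      ∑ i : Fin n, g (x i.succ) /
        ((x i.succ - x 0) * ∏ j ∈ Finset.univ.erase i, (x i.succ - x j.succ)) := by
  rw [dividedDiff, Fin.sum_univ_succ, prod_univ_erase_eq _ 0]
  simp only [prod_univ_erase_succ, Fin.zero_succAbove]

/-- The law of `∑ i, x i * E i`, for independent standard exponential variables `E i` and distinct
`x i`, is the divided difference in `a` of `a ^ n` times the law of `a * E`. -/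
theorem HasQuadraticGrowth.integral_sum_eq {φ : ℝ → ℝ} (hφ : HasQuadraticGrowth φ) {n : ℕ}
    {x : Fin (n + 1) → ℝ} (hx : Function.Injective x) (s : ℝ) :
    ∫ y, φ (s + ∑ i, x i * y i) ∂(Measure.pi fun _ : Fin (n + 1) => gammaWeight 0) =
      dividedDiff (fun a => a ^ n * expAverage a φ s) x := by
  induction n generalizing φ with
  | zero =>
    rw [hφ.integral_sum_succ]
    simp [dividedDiff]
  | succ n ih =>
    have hx' : Function.Injective fun i : Fin (n + 1) => x i.succ :=
      hx.comp (Fin.succ_injective _)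
    have hne : ∀ i : Fin (n + 1), x i.succ - x 0 ≠ 0 := fun i =>
      sub_ne_zero.2 (hx.ne (Fin.succ_ne_zero i))
    have h0 := dividedDiff_pow_of_lt (r := n) (by omega) hx
    rw [hφ.integral_sum_succ, ih (hφ.expAverage (x 0)) hx']
    rw [dividedDiff_succ] at h0
    rw [dividedDiff_succ _ x, dividedDiff]
    -- the terms with `expAverage (x 0) φ` are collected by the vanishing of the divided difference
    -- of `t ^ n` at `n + 2` nodes
    have h1 : ∀ i : Fin (n + 1), x i.succ ^ n * expAverage (x i.succ) (expAverage (x 0) φ) s /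
        ∏ j ∈ Finset.univ.erase i, (x i.succ - x j.succ) =
        x i.succ ^ (n + 1) * expAverage (x i.succ) φ s /
          ((x i.succ - x 0) * ∏ j ∈ Finset.univ.erase i, (x i.succ - x j.succ)) -
        x 0 * expAverage (x 0) φ s * (x i.succ ^ n /
          ((x i.succ - x 0) * ∏ j ∈ Finset.univ.erase i, (x i.succ - x j.succ))) := by
      intro i
      have := hne i
      have h2 : ∏ j ∈ Finset.univ.erase i, (x i.succ - x j.succ) ≠ 0 :=
        Finset.prod_ne_zero_iff.2 fun j hj => sub_ne_zero.2
          (hx'.ne (Finset.ne_of_mem_erase hj).symm)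
      rw [hφ.expAverage_expAverage (sub_ne_zero.1 this)]
      field_simp
      ring
    simp only [h1, Finset.sum_sub_distrib, ← Finset.mul_sum]
    rw [eq_neg_of_add_eq_zero_right h0]
    ring

theorem hasQuadraticGrowth_id : HasQuadraticGrowth fun s => s := by
  refine ⟨continuous_id, 1, fun s => ?_⟩
  nlinarith [abs_nonneg s]

theorem hasQuadraticGrowth_mul_log : HasQuadraticGrowth fun s => s * log s := by
  refine ⟨continuous_mul_log, 1, fun s => ?_⟩
  have h := abs_pow_succ_mul_log_le (abs_nonneg s) 0
  rw [log_abs, abs_mul, zero_add, pow_one, abs_abs, zero_add] at h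
  rw [abs_mul]
  nlinarith [abs_nonneg s]

theorem expAverage_id_zero (a : ℝ) : expAverage a (fun s => s) 0 = a := by
  have h := integral_pow_gammaWeight 0 1
  simp only [pow_one] at h
  simp only [expAverage, zero_add]
  rw [integral_const_mul, h]
  simp

theorem expAverage_mul_log_zero (a : ℝ) :
    expAverage a (fun s => s * log s) 0 = a * log a + a * (1 - eulerMascheroniConstant) := by
  have h1 := integral_pow_gammaWeight 0 1
  have h2 := integral_pow_log_gammaWeight 0 1
  have i1 := integrable_pow_gammaWeight 0 1
  have i2 := integrable_pow_log_gammaWeight 0 0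
  simp only [pow_one, zero_add, Nat.factorial_one, Nat.cast_one, one_mul] at h1 h2 i1 i2
  rcases eq_or_ne a 0 with rfl | ha
  · simp [expAverage]
  have h3 : expAverage a (fun s => s * log s) 0 =
      ∫ x, (a * log a) * x + a * (x * log x) ∂gammaWeight 0 := by
    refine integral_congr_ae ?_
    filter_upwards [ae_gammaWeight_pos 0] with x hx
    simp only [zero_add]
    rw [log_mul ha hx.ne']
    ring
  rw [h3, integral_add (i1.const_mul _) (i2.const_mul _), integral_const_mul, integral_const_mul,
    h1, h2]
  simp [harmonic]

theorem integral_sum_mul_pi_gammaWeight {ι : Type*} [Fintype ι] (x : ι → ℝ) :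
    ∫ y, ∑ i, x i * y i ∂(Measure.pi fun _ : ι => gammaWeight 0) = ∑ i, x i := by
  have hi : ∀ i, Integrable (fun y : ι → ℝ => y i) (Measure.pi fun _ : ι => gammaWeight 0) := by
    intro i
    exact integrable_comp_eval (μ := fun _ : ι => gammaWeight 0) (i := i) (f := fun t => t)
      (by simpa using integrable_pow_gammaWeight 0 1)
  rw [integral_finsetSum _ fun i _ => (hi i).const_mul _]
  refine Finset.sum_congr rfl fun i _ => ?_
  rw [integral_const_mul,
    integral_comp_eval (μ := fun _ : ι => gammaWeight 0) (i := i) (f := fun t => t)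
      (by fun_prop)]
  have h := integral_pow_gammaWeight 0 1
  simp only [pow_one] at h
  simp [h]

/-- The divided difference of `t ^ n` at `n` nodes is their sum. -/
theorem dividedDiff_pow_card {n : ℕ} {x : Fin n → ℝ} (hx : Function.Injective x) :
    dividedDiff (fun t => t ^ n) x = ∑ i, x i := by
  cases n with
  | zero => simp [dividedDiff]
  | succ n =>
    have h := hasQuadraticGrowth_id.integral_sum_eq hx 0
    simp only [expAverage_id_zero, zero_add, integral_sum_mul_pi_gammaWeight] at h
    rw [h]
    rfl

/-- The mean of `S * log S` for `S = ∑ i, x i * E i`, where the `E i` are independent standard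
exponential variables. On the simplex this is `1 - γ` minus the subentropy. -/
noncomputable def meanMulLog {n : ℕ} (x : Fin n → ℝ) : ℝ :=
  ∫ y, (∑ i, x i * y i) * log (∑ i, x i * y i) ∂(Measure.pi fun _ : Fin n => gammaWeight 0)

theorem integrable_sum_mul_log {n : ℕ} (x : Fin n → ℝ) :
    Integrable (fun y => (∑ i, x i * y i) * log (∑ i, x i * y i))
      (Measure.pi fun _ : Fin n => gammaWeight 0) := by
  simpa using hasQuadraticGrowth_mul_log.integrable_sum x 0

theorem subentropyFormula_eq_meanMulLog {n : ℕ} {x : Fin (n + 1) → ℝ}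
    (hx : Function.Injective x) (h1 : ∑ i, x i = 1) :
    subentropyFormula x = 1 - eulerMascheroniConstant - meanMulLog x := by
  have h := hasQuadraticGrowth_mul_log.integral_sum_eq hx 0
  have h2 := dividedDiff_pow_card hx
  simp only [expAverage_mul_log_zero, zero_add] at h
  have h3 : dividedDiff
      (fun a => a ^ n * (a * log a + a * (1 - eulerMascheroniConstant))) x =
      dividedDiff (fun t => t ^ (n + 1) * log t) x +
        dividedDiff (fun t => t ^ (n + 1)) x * (1 - eulerMascheroniConstant) := by
    simp only [dividedDiff, Finset.sum_mul, ← Finset.sum_add_distrib]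
    exact Finset.sum_congr rfl fun i _ => by ring
  rw [meanMulLog, h, subentropyFormula_eq, h3, h2, h1]
  ring

theorem HasQuadraticGrowth.continuousOn_integral_sum {φ : ℝ → ℝ} (hφ : HasQuadraticGrowth φ)
    (n : ℕ) : ContinuousOn
      (fun x : Fin n → ℝ => ∫ y, φ (∑ i, x i * y i) ∂(Measure.pi fun _ : Fin n => gammaWeight 0))
      (stdSimplex ℝ (Fin n)) := by
  intro x hx
  obtain ⟨hc, C, hC⟩ := hφ
  have hC0 := HasQuadraticGrowth.bound_nonneg hC
  have hb : Integrable (fun y : Fin n → ℝ => C * ∏ i, (1 + |1 * y i|) ^ 2)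
      (Measure.pi fun _ : Fin n => gammaWeight 0) :=
    (Integrable.fintype_prod (f := fun i t => (1 + |1 * t|) ^ 2)
      fun i => integrable_one_add_abs_pow 1 0 2).const_mul C
  refine continuousWithinAt_of_dominated
    (F := fun (x : Fin n → ℝ) (y : Fin n → ℝ) => φ (∑ i, x i * y i))
    (bound := fun y => C * ∏ i, (1 + |1 * y i|) ^ 2) ?_ ?_ hb ?_
  · exact Filter.Eventually.of_forall fun z =>
      (hc.comp (by fun_prop : Continuous fun y : Fin n → ℝ => ∑ i, z i * y i)).aestronglyMeasurable
  · filter_upwards [self_mem_nhdsWithin] with z hz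
    refine Filter.Eventually.of_forall fun y => (hC _).trans ?_
    rw [Finset.prod_pow]
    gcongr
    have h1 := one_add_abs_add_sum_le Finset.univ 0 fun i => z i * y i
    simp only [zero_add, abs_zero, add_zero, one_mul] at h1 ⊢
    refine h1.trans (Finset.prod_le_prod (fun i _ => by positivity) fun i _ => ?_)
    rw [abs_mul]
    have h2 : |z i| ≤ 1 := by
      rw [abs_of_nonneg (hz.1 i), ← hz.2]
      exact Finset.single_le_sum (fun j _ => hz.1 j) (Finset.mem_univ i)
    have := mul_le_mul_of_nonneg_right h2 (abs_nonneg (y i))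
    linarith
  · refine Filter.Eventually.of_forall fun y => ContinuousAt.continuousWithinAt ?_
    exact (hc.comp (by fun_prop : Continuous fun z : Fin n → ℝ => ∑ i, z i * y i)).continuousAt

theorem continuousOn_meanMulLog (n : ℕ) :
    ContinuousOn (meanMulLog (n := n)) (stdSimplex ℝ (Fin n)) :=
  hasQuadraticGrowth_mul_log.continuousOn_integral_sum n

theorem stdSimplex_subset_closure_simpleSpectra (m : ℕ) :
    stdSimplex ℝ (Fin m) ⊆ closure (simpleSpectra m) := by
  intro x hx
  have hm : 0 < m := by
    rcases Nat.eq_zero_or_pos m with rfl | h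
    · have := hx.2; simp at this
    · exact h
  -- a probability vector with distinct entries
  obtain ⟨b, hb, hbi⟩ : ∃ b ∈ stdSimplex ℝ (Fin m), Function.Injective b := by
    have hS : 0 < ∑ i : Fin m, ((i : ℝ) + 1) :=
      Finset.sum_pos (fun i _ => by positivity) ⟨⟨0, hm⟩, Finset.mem_univ _⟩
    refine ⟨fun i => ((i : ℝ) + 1) / ∑ i : Fin m, ((i : ℝ) + 1), ⟨fun i => by positivity, ?_⟩, ?_⟩
    · rw [← Finset.sum_div, div_self hS.ne']
    · intro i j hij
      have := (div_left_inj' hS.ne').1 hij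
      exact Fin.ext (by exact_mod_cast add_right_cancel this)
  have hlim : Filter.Tendsto (fun t : ℝ => (1 - t) • x + t • b) (nhdsWithin 0 (Ioi 0))
      (nhds x) := by
    have : Continuous fun t : ℝ => (1 - t) • x + t • b := by fun_prop
    have h := (this.tendsto 0).mono_left (nhdsWithin_le_nhds (s := Ioi 0))
    simpa using h
  refine mem_closure_of_tendsto hlim ?_
  have hpos : ∀ᶠ t : ℝ in nhdsWithin 0 (Ioi 0), 0 < t := self_mem_nhdsWithin
  have hlt : ∀ᶠ t : ℝ in nhdsWithin 0 (Ioi 0), t < 1 :=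
    (eventually_lt_nhds one_pos).filter_mono nhdsWithin_le_nhds
  have hne : ∀ i j, i ≠ j → ∀ᶠ t : ℝ in nhdsWithin 0 (Ioi 0),
      ((1 - t) • x + t • b) i ≠ ((1 - t) • x + t • b) j := by
    intro i j hij
    by_cases hxij : x i = x j
    · filter_upwards [hpos] with t ht h
      simp only [Pi.add_apply, Pi.smul_apply, smul_eq_mul, hxij, add_right_inj] at h
      exact hij (hbi (mul_left_cancel₀ ht.ne' h))
    · have h1 := ((continuous_apply i).tendsto x).comp hlim
      have h2 := ((continuous_apply j).tendsto x).comp hlim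
      filter_upwards [(h1.sub h2).eventually_ne (sub_ne_zero.2 hxij)] with t ht
      exact sub_ne_zero.1 ht
  have hall : ∀ᶠ t : ℝ in nhdsWithin 0 (Ioi 0), ∀ i j, i ≠ j →
      ((1 - t) • x + t • b) i ≠ ((1 - t) • x + t • b) j := by
    rw [Filter.eventually_all]; intro i
    rw [Filter.eventually_all]; intro j
    by_cases hij : i = j
    · exact Filter.Eventually.of_forall fun t h => absurd hij h
    · filter_upwards [hne i j hij] with t ht _ using ht
  filter_upwards [hpos, hlt, hall] with t h0 h1 h2
  refine ⟨convex_stdSimplex ℝ _ hx hb (by linarith) h0.le (by ring), fun i j hij => ?_⟩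
  by_contra h
  exact h2 i j h hij

/-- The probabilistic form of the subentropy, which also covers repeated eigenvalues. -/
theorem spectralSubentropy_eq {m : ℕ} {x : Fin m → ℝ} (hx : x ∈ stdSimplex ℝ (Fin m)) :
    spectralSubentropy x = 1 - eulerMascheroniConstant - meanMulLog x := by
  refine extendFrom_eq (stdSimplex_subset_closure_simpleSpectra m hx) ?_
  have h : ContinuousWithinAt (fun z => 1 - eulerMascheroniConstant - meanMulLog z)
      (simpleSpectra m) x := continuousWithinAt_const.sub
    ((continuousOn_meanMulLog m x hx).mono fun z hz => hz.1)
  refine Filter.Tendsto.congr' ?_ h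
  filter_upwards [self_mem_nhdsWithin] with z hz
  cases m with
  | zero => have := hx.2; simp at this
  | succ n => exact (subentropyFormula_eq_meanMulLog hz.2 hz.1.2).symm

theorem spectralSubentropy_eq_formula {m : ℕ} {x : Fin m → ℝ} (hx : x ∈ stdSimplex ℝ (Fin m))
    (hi : Function.Injective x) : spectralSubentropy x = subentropyFormula x := by
  rw [spectralSubentropy_eq hx]
  cases m with
  | zero => have := hx.2; simp at this
  | succ n => exact (subentropyFormula_eq_meanMulLog hi hx.2).symm

/-- Jensen's inequality for `S * log S`, as `S` has mean one. -/
theorem meanMulLog_nonneg {m : ℕ} {x : Fin m → ℝ} (hx : x ∈ stdSimplex ℝ (Fin m)) :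
    0 ≤ meanMulLog x := by
  have hi := hasQuadraticGrowth_id.integrable_sum x 0
  simp only [zero_add] at hi
  have h : ∫ y, (∑ i, x i * y i) - 1 ∂(Measure.pi fun _ : Fin m => gammaWeight 0) = 0 := by
    rw [integral_sub hi (integrable_const _), integral_sum_mul_pi_gammaWeight, hx.2]
    simp
  rw [← h]
  refine integral_mono_ae (hi.sub (integrable_const _)) (integrable_sum_mul_log x) ?_
  filter_upwards [ae_pi_gammaWeight_pos 0] with y hy
  have hs : 0 ≤ ∑ i, x i * y i := Finset.sum_nonneg fun i _ => mul_nonneg (hx.1 i) (hy i).le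
  rcases hs.eq_or_lt with h0 | h0
  · rw [← h0]; simp
  · have h1 := one_sub_inv_le_log_of_pos h0
    have h2 := mul_le_mul_of_nonneg_left h1 hs
    rwa [mul_sub, mul_one, mul_inv_cancel₀ h0.ne'] at h2

theorem spectralSubentropy_le {m : ℕ} {x : Fin m → ℝ} (hx : x ∈ stdSimplex ℝ (Fin m)) :
    spectralSubentropy x ≤ 1 - eulerMascheroniConstant := by
  rw [spectralSubentropy_eq hx]
  linarith [meanMulLog_nonneg hx]

theorem continuousOn_spectralSubentropy (m : ℕ) :
    ContinuousOn (spectralSubentropy (m := m)) (stdSimplex ℝ (Fin m)) :=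
  (continuousOn_const.sub (continuousOn_meanMulLog m)).congr fun _ hx => spectralSubentropy_eq hx

theorem exists_abs_spectralSubentropy_le (m : ℕ) :
    ∃ C, ∀ x ∈ stdSimplex ℝ (Fin m), |spectralSubentropy x| ≤ C := by
  obtain ⟨C, hC⟩ := (isCompact_stdSimplex ℝ (Fin m)).exists_bound_of_continuousOn
    (continuousOn_spectralSubentropy m)
  exact ⟨C, hC⟩

/-! ### The Laguerre ensemble -/

theorem vandermondeProduct_eq_det {n : ℕ} (x : Fin n → ℝ) :
    vandermondeProduct x = (Matrix.vandermonde fun i => -x i).det := by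
  rw [Matrix.det_vandermonde]
  simp only [vandermondeProduct]
  refine Finset.prod_congr rfl fun i _ => Finset.prod_congr rfl fun j _ => by ring

theorem vandermondeProduct_ne_zero_iff {n : ℕ} {x : Fin n → ℝ} :
    vandermondeProduct x ≠ 0 ↔ Function.Injective x := by
  rw [vandermondeProduct_eq_det, Matrix.det_vandermonde_ne_zero_iff]
  exact ⟨fun h i j hij => h (by simp [hij]), fun h i j hij => h (neg_injective hij)⟩

theorem vandermondeProduct_comp_perm_sq {n : ℕ} (x : Fin n → ℝ) (σ : Equiv.Perm (Fin n)) :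
    vandermondeProduct (fun i => x (σ i)) ^ 2 = vandermondeProduct x ^ 2 := by
  rw [vandermondeProduct_eq_det, vandermondeProduct_eq_det]
  have h := Matrix.det_permute σ (Matrix.vandermonde fun i => -x i)
  have h2 : (Matrix.vandermonde fun i => -x (σ i)) =
      (Matrix.vandermonde fun i => -x i).submatrix σ id := by
    ext i j; simp [Matrix.vandermonde]
  rw [h2, h, mul_pow]
  rcases Int.units_eq_one_or (Equiv.Perm.sign σ) with h3 | h3 <;> simp [h3]

theorem vandermondeProduct_succ {n : ℕ} (x : Fin (n + 1) → ℝ) :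
    vandermondeProduct x = (∏ j : Fin n, (x 0 - x j.succ)) *
      vandermondeProduct fun j : Fin n => x j.succ := by
  simp only [vandermondeProduct]
  rw [Fin.prod_univ_succ, Fin.prod_Ioi_zero]
  simp only [Fin.prod_Ioi_succ]

theorem vandermondeProduct_sq_eq_succAbove {n : ℕ} (x : Fin (n + 1) → ℝ) (i : Fin (n + 1)) :
    vandermondeProduct x ^ 2 = (∏ j : Fin n, (x i - x (i.succAbove j))) ^ 2 *
      vandermondeProduct (fun j : Fin n => x (i.succAbove j)) ^ 2 := by
  rw [← vandermondeProduct_comp_perm_sq x i.cycleRange.symm, vandermondeProduct_succ, mul_pow]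
  simp only [Fin.cycleRange_symm_zero, Fin.cycleRange_symm_succ]

theorem vandermondeProduct_smul_sq {n : ℕ} (r : ℝ) (x : Fin n → ℝ) :
    vandermondeProduct (r • x) ^ 2 = r ^ (n * (n - 1)) * vandermondeProduct x ^ 2 := by
  induction n with
  | zero => simp [vandermondeProduct]
  | succ n ih =>
    have h : (fun j : Fin n => (r • x) j.succ) = r • fun j : Fin n => x j.succ := rfl
    rw [vandermondeProduct_succ, vandermondeProduct_succ, h, mul_pow, ih]
    simp only [Pi.smul_apply, smul_eq_mul, ← mul_sub, Finset.prod_mul_distrib, Finset.prod_const,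
      Finset.card_univ, Fintype.card_fin]
    cases n with
    | zero => simp
    | succ n =>
      simp only [Nat.add_sub_cancel]
      ring

/-- The Vandermonde product as a polynomial. -/
noncomputable def vandermondePoly (n : ℕ) : MvPolynomial (Fin n) ℝ :=
  ∏ i, ∏ j ∈ Finset.Ioi i, (MvPolynomial.X i - MvPolynomial.X j)

theorem eval_vandermondePoly {n : ℕ} (x : Fin n → ℝ) :
    MvPolynomial.eval x (vandermondePoly n) = vandermondeProduct x := by
  simp [vandermondePoly, vandermondeProduct, map_prod]

theorem continuous_vandermondeProduct (n : ℕ) :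
    Continuous (vandermondeProduct : (Fin n → ℝ) → ℝ) := by
  unfold vandermondeProduct
  fun_prop

/-- Heine's integral `∫ ∏ j, (u - y j) Δ(y) ^ 2` over the Laguerre weight, a multiple of the
`n`-th monic orthogonal polynomial. -/
noncomputable def heineIntegral (a n : ℕ) (u : ℝ) : ℝ :=
  ∫ y, (∏ j, (u - y j)) * vandermondeProduct y ^ 2 ∂(Measure.pi fun _ : Fin n => gammaWeight a)

/-- The factor `Δ ^ 2` cancels the denominators of a divided difference; the identity also holds at
coinciding nodes, where both sides vanish. -/
theorem dividedDiff_mul_vandermonde_sq (g : ℝ → ℝ) {n : ℕ} (x : Fin (n + 1) → ℝ) :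
    dividedDiff g x * vandermondeProduct x ^ 2 =
      ∑ i, g (x i) * ((∏ j, (x i - x (i.succAbove j))) *
        vandermondeProduct (fun j => x (i.succAbove j)) ^ 2) := by
  rw [dividedDiff, Finset.sum_mul]
  refine Finset.sum_congr rfl fun i _ => ?_
  rw [prod_univ_erase_eq, vandermondeProduct_sq_eq_succAbove x i]
  rcases eq_or_ne (∏ j, (x i - x (i.succAbove j))) 0 with h | h
  · simp [h]
  · field_simp

theorem integrable_mul_prod_sub_mul_vandermonde_sq {a n : ℕ} {g : ℝ → ℝ}
    (hg : ∀ e : ℕ, Integrable (fun x => g x * x ^ e) (gammaWeight a)) (i : Fin (n + 1)) :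
    Integrable (fun x : Fin (n + 1) → ℝ => g (x i) * ((∏ j, (x i - x (i.succAbove j))) *
      vandermondeProduct (fun j => x (i.succAbove j)) ^ 2))
      (Measure.pi fun _ : Fin (n + 1) => gammaWeight a) := by
  refine (integrable_pi_mul_mvPolynomial (integrable_pow_gammaWeight a) hg i
    ((∏ j, (MvPolynomial.X i - MvPolynomial.X (i.succAbove j))) *
      (MvPolynomial.rename i.succAbove (vandermondePoly n)) ^ 2)).congr
    (Filter.Eventually.of_forall fun x => ?_)
  simp only [map_mul, map_prod, map_sub, MvPolynomial.eval_X, map_pow, MvPolynomial.eval_rename,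
    eval_vandermondePoly]
  rfl

theorem integrable_dividedDiff_mul_vandermonde_sq {a n : ℕ} {g : ℝ → ℝ}
    (hg : ∀ e : ℕ, Integrable (fun x => g x * x ^ e) (gammaWeight a)) :
    Integrable (fun x => dividedDiff g x * vandermondeProduct x ^ 2)
      (Measure.pi fun _ : Fin (n + 1) => gammaWeight a) := by
  simp only [dividedDiff_mul_vandermonde_sq]
  exact integrable_finsetSum _ fun i _ => integrable_mul_prod_sub_mul_vandermonde_sq hg i

/-- By symmetry, the average of a divided difference over the Laguerre ensemble reduces to a
one-dimensional integral against Heine's polynomial. -/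
theorem integral_dividedDiff_mul_vandermonde_sq {a n : ℕ} {g : ℝ → ℝ}
    (hg : ∀ e : ℕ, Integrable (fun x => g x * x ^ e) (gammaWeight a)) :
    ∫ x, dividedDiff g x * vandermondeProduct x ^ 2
      ∂(Measure.pi fun _ : Fin (n + 1) => gammaWeight a) =
      (n + 1) * ∫ u, g u * heineIntegral a n u ∂gammaWeight a := by
  simp only [dividedDiff_mul_vandermonde_sq]
  rw [integral_finsetSum _ fun i _ => integrable_mul_prod_sub_mul_vandermonde_sq hg i]
  have h : ∀ i : Fin (n + 1), ∫ x, g (x i) * ((∏ j, (x i - x (i.succAbove j))) *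
      vandermondeProduct (fun j => x (i.succAbove j)) ^ 2)
      ∂(Measure.pi fun _ : Fin (n + 1) => gammaWeight a) =
      ∫ u, g u * heineIntegral a n u ∂gammaWeight a := by
    intro i
    have hmp := measurePreserving_piFinSuccAbove (fun _ : Fin (n + 1) => gammaWeight a) i
    have hi := integrable_mul_prod_sub_mul_vandermonde_sq hg i
    set F : ℝ × (Fin n → ℝ) → ℝ := fun p =>
      g p.1 * ((∏ j, (p.1 - p.2 j)) * vandermondeProduct p.2 ^ 2) with hF
    have hi2 : Integrable F ((gammaWeight a).prod (Measure.pi fun _ : Fin n => gammaWeight a)) :=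
      (hmp.integrable_comp_emb (MeasurableEquiv.measurableEmbedding _) (g := F)).1 hi
    calc _ = ∫ x, F (MeasurableEquiv.piFinSuccAbove (fun _ => ℝ) i x)
          ∂(Measure.pi fun _ : Fin (n + 1) => gammaWeight a) := rfl
      _ = ∫ p, F p ∂((gammaWeight a).prod (Measure.pi fun _ : Fin n => gammaWeight a)) :=
          hmp.integral_comp' (g := F)
      _ = _ := by
          rw [integral_prod _ hi2]
          simp only [hF, integral_const_mul, heineIntegral]
  simp only [h, Finset.sum_const, Finset.card_univ, Fintype.card_fin, nsmul_eq_mul]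
  push_cast
  ring

/-- Orthogonality holds because the divided difference of `t ^ r` vanishes. -/
theorem heineIntegral_orthogonal {a n r : ℕ} (hr : r < n) :
    ∫ u, u ^ r * heineIntegral a n u ∂gammaWeight a = 0 := by
  have h := integral_dividedDiff_mul_vandermonde_sq (a := a) (n := n) (g := fun t => t ^ r)
    fun e => by simpa only [pow_add] using integrable_pow_gammaWeight a (r + e)
  have h2 : ∀ x : Fin (n + 1) → ℝ,
      dividedDiff (fun t => t ^ r) x * vandermondeProduct x ^ 2 = 0 := by
    intro x
    by_cases hx : Function.Injective x
    · rw [dividedDiff_pow_of_lt (by omega) hx, zero_mul]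
    · rw [not_not.1 (mt vandermondeProduct_ne_zero_iff.1 hx)]; simp
  simp only [h2, integral_zero] at h
  rcases mul_eq_zero.1 h.symm with h | h
  · exact absurd h (by positivity)
  · exact h

theorem integral_pow_mul_heineIntegral (a n : ℕ) :
    (n + 1) * ∫ u, u ^ n * heineIntegral a n u ∂gammaWeight a =
      ∫ x, vandermondeProduct x ^ 2 ∂(Measure.pi fun _ : Fin (n + 1) => gammaWeight a) := by
  rw [← integral_dividedDiff_mul_vandermonde_sq (a := a) (n := n) (g := fun t => t ^ n)
    fun e => by simpa only [pow_add] using integrable_pow_gammaWeight a (n + e)]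
  refine integral_congr_ae (Filter.Eventually.of_forall fun x => ?_)
  by_cases hx : Function.Injective x
  · simp only [dividedDiff_pow_self hx, one_mul]
  · simp only [not_not.1 (mt vandermondeProduct_ne_zero_iff.1 hx)]; simp

theorem integrable_prod_sub_mul_vandermonde_sq (a n : ℕ) (u : ℝ) :
    Integrable (fun y : Fin n → ℝ => (∏ j, (u - y j)) * vandermondeProduct y ^ 2)
      (Measure.pi fun _ : Fin n => gammaWeight a) := by
  refine (integrable_pi_mvPolynomial (integrable_pow_gammaWeight a)
    ((∏ j, (MvPolynomial.C u - MvPolynomial.X j)) * (vandermondePoly n) ^ 2)).congr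
    (Filter.Eventually.of_forall fun x => ?_)
  simp [map_prod, eval_vandermondePoly]

theorem integrable_vandermonde_sq (a n : ℕ) :
    Integrable (fun y : Fin n → ℝ => vandermondeProduct y ^ 2)
      (Measure.pi fun _ : Fin n => gammaWeight a) := by
  refine (integrable_pi_mvPolynomial (integrable_pow_gammaWeight a) ((vandermondePoly n) ^ 2)).congr
    (Filter.Eventually.of_forall fun x => ?_)
  simp [eval_vandermondePoly]

/-- Heine's integral is a polynomial of degree at most `n`, being determined by interpolation
at `n + 1` nodes. -/
theorem exists_polynomial_heineIntegral (a n : ℕ) :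
    ∃ c : ℕ → ℝ, ∀ u, heineIntegral a n u = ∑ d ∈ Finset.range (n + 1), c d * u ^ d := by
  set v : ℕ → ℝ := fun i => i
  have hv : Set.InjOn v (Finset.range (n + 1)) := Nat.cast_injective.injOn
  set p := Lagrange.interpolate (Finset.range (n + 1)) v fun i => heineIntegral a n i with hp
  have hdeg : p.natDegree < n + 1 := by
    have := Lagrange.degree_interpolate_lt (r := fun i : ℕ => heineIntegral a n i) hv
    rw [Finset.card_range] at this
    by_cases h0 : p = 0
    · rw [h0]; simp
    · exact (Polynomial.natDegree_lt_iff_degree_lt h0).2 this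
  refine ⟨p.coeff, fun u => ?_⟩
  rw [← Polynomial.eval_eq_sum_range' hdeg, hp, Lagrange.interpolate_apply,
    Polynomial.eval_finsetSum]
  simp only [Polynomial.eval_mul, Polynomial.eval_C, heineIntegral, ← integral_mul_const]
  rw [← integral_finsetSum _ fun (i : ℕ) _ =>
    (integrable_prod_sub_mul_vandermonde_sq a n (i : ℝ)).mul_const _]
  refine integral_congr_ae (Filter.Eventually.of_forall fun y => ?_)
  have h := Lagrange.eq_interpolate hv (f := ∏ j : Fin n, (Polynomial.X - Polynomial.C (y j)))
    (by rw [Polynomial.degree_prod]; simpa using by exact_mod_cast n.lt_succ_self)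
  have h2 := congrArg (Polynomial.eval u) h
  rw [Lagrange.interpolate_apply, Polynomial.eval_finsetSum, Polynomial.eval_prod] at h2
  simp only [Polynomial.eval_sub, Polynomial.eval_X, Polynomial.eval_C, Polynomial.eval_mul,
    Polynomial.eval_prod] at h2
  simp only [h2, Finset.sum_mul]
  refine Finset.sum_congr rfl fun i _ => ?_
  simp only [v]
  ring

theorem hasDerivAt_prod_sub (f : ℕ → ℝ) (d : ℕ) {s : ℝ} (h : ∀ j < d, s - f j ≠ 0) :
    HasDerivAt (fun s => ∏ j ∈ Finset.range d, (s - f j))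
      ((∏ j ∈ Finset.range d, (s - f j)) * ∑ j ∈ Finset.range d, 1 / (s - f j)) s := by
  induction d with
  | zero => simpa using hasDerivAt_const s (1 : ℝ)
  | succ d ih =>
    have h1 := (ih fun j hj => h j (by omega)).mul ((hasDerivAt_id s).sub_const (f d))
    simp only [Finset.prod_range_succ, Finset.sum_range_succ]
    refine h1.congr_deriv ?_
    have := h d (by omega)
    simp only [id]
    field_simp

theorem factorial_add_eq_prod (b d : ℕ) :
    ((b + d).factorial : ℝ) = b.factorial * ∏ j ∈ Finset.range d, ((b : ℝ) - -(1 + j)) := by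
  induction d with
  | zero => simp
  | succ d ih =>
    rw [← add_assoc, Nat.factorial_succ, Finset.prod_range_succ, ← mul_assoc, ← ih]
    push_cast; ring

theorem harmonic_add_eq_sum (b d : ℕ) :
    (harmonic (b + d) : ℝ) =
      harmonic b + ∑ j ∈ Finset.range d, 1 / ((b : ℝ) - -(1 + j)) := by
  induction d with
  | zero => simp
  | succ d ih =>
    rw [← add_assoc, harmonic_succ, Finset.sum_range_succ, ← add_assoc, ← ih]
    push_cast
    rw [one_div]
    congr 2; ring

/-- If the moments of order `< n` of `∑ d, c d * u ^ d` for the weight `u ^ a * exp (-u)` vanish,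
then the Mellin transform is a Gamma factor times a multiple of `∏ j < n, (s - j)`, which
determines the logarithmic moment from the `n`-th moment. Here `q`, with
`Γ(a + 1 + s) * q s` the Mellin transform, is a polynomial of degree at most `n`, and the logarithmic
moment is a derivative of the Mellin transform at `n + 1`. -/
theorem log_moment_of_orthogonal (a n : ℕ) (c : ℕ → ℝ) (γ : ℝ)
    (h : ∀ r < n, ∑ d ∈ Finset.range (n + 1), c d * ((a + r + d).factorial : ℝ) = 0) :
    ∑ d ∈ Finset.range (n + 1), c d * (((a + (n + 1) + d).factorial : ℝ) *
        ((harmonic (a + (n + 1) + d) : ℝ) - γ)) =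
      (n + 1) * (a + n + 1) * ((harmonic (a + n + 1) : ℝ) - γ + harmonic (n + 1) - 1) *
        ∑ d ∈ Finset.range (n + 1), c d * ((a + n + d).factorial : ℝ) := by
  set q : Polynomial ℝ := ∑ d ∈ Finset.range (n + 1), Polynomial.C (c d) *
    ∏ j ∈ Finset.range d, (Polynomial.X - Polynomial.C (-((a : ℝ) + 1 + j))) with hq
  have hqe : ∀ s, q.eval s = ∑ d ∈ Finset.range (n + 1), c d *
      ∏ j ∈ Finset.range d, (s - -((a : ℝ) + 1 + j)) := by
    intro s
    simp only [hq, Polynomial.eval_finsetSum, Polynomial.eval_mul, Polynomial.eval_C,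
      Polynomial.eval_prod, Polynomial.eval_sub, Polynomial.eval_X]
  have hmom : ∀ r : ℕ, ∑ d ∈ Finset.range (n + 1), c d * ((a + r + d).factorial : ℝ) =
      (a + r).factorial * q.eval (r : ℝ) := by
    intro r
    rw [hqe, Finset.mul_sum]
    refine Finset.sum_congr rfl fun d _ => ?_
    rw [factorial_add_eq_prod (a + r) d, mul_left_comm]
    congr 2
    refine Finset.prod_congr rfl fun j _ => ?_
    push_cast; ring
  have hzero : ∀ r < n, q.eval (r : ℝ) = 0 := by
    intro r hr
    have := h r hr
    rw [hmom] at this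
    exact (mul_eq_zero.1 this).resolve_left (by positivity)
  have hdeg : q.natDegree ≤ n := by
    refine Polynomial.natDegree_sum_le_of_forall_le _ _ fun d hd => ?_
    refine (Polynomial.natDegree_C_mul_le _ _).trans ?_
    rw [Polynomial.natDegree_prod_of_monic _ _ fun j _ => Polynomial.monic_X_sub_C _]
    simp only [Polynomial.natDegree_X_sub_C, Finset.sum_const, Finset.card_range, smul_eq_mul,
      mul_one]
    have := Finset.mem_range.1 hd
    omega
  set κ := q.eval (n : ℝ) / n.factorial with hκ
  have hfact : ∀ n : ℕ, ∏ j ∈ Finset.range n, ((n : ℝ) - j) = n.factorial := by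
    intro n
    rw [← Finset.prod_range_reflect, ← Finset.prod_range_add_one_eq_factorial]
    push_cast
    refine Finset.prod_congr rfl fun j hj => ?_
    have := Finset.mem_range.1 hj
    rw [Nat.cast_sub (by omega), Nat.cast_sub (by omega)]
    push_cast; ring
  -- `q` has the `n` roots `0, …, n - 1`
  have hfac : ∀ s, q.eval s = κ * ∏ j ∈ Finset.range n, (s - (j : ℝ)) := by
    set p : Polynomial ℝ := Polynomial.C κ *
      ∏ j ∈ Finset.range n, (Polynomial.X - Polynomial.C (j : ℝ)) with hp
    have hpe : ∀ s, p.eval s = κ * ∏ j ∈ Finset.range n, (s - (j : ℝ)) := by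
      intro s
      simp only [hp, Polynomial.eval_mul, Polynomial.eval_C, Polynomial.eval_prod,
        Polynomial.eval_sub, Polynomial.eval_X]
    have hpd : p.natDegree ≤ n := by
      refine (Polynomial.natDegree_C_mul_le _ _).trans ?_
      rw [Polynomial.natDegree_prod_of_monic _ _ fun j _ => Polynomial.monic_X_sub_C _]
      simp only [Polynomial.natDegree_X_sub_C, Finset.sum_const, Finset.card_range, smul_eq_mul,
        mul_one, le_refl]
    have hqp : q = p := by
      refine Polynomial.eq_of_degree_sub_lt_of_eval_index_eq
        (v := fun j : ℕ => (j : ℝ)) (Finset.range (n + 1)) Nat.cast_injective.injOn ?_ fun r hr => ?_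
      · rw [Finset.card_range]
        refine Polynomial.degree_le_natDegree.trans_lt ?_
        have := (Polynomial.natDegree_sub_le q p).trans (max_le hdeg hpd)
        exact_mod_cast Nat.lt_succ_of_le this
      · rw [hpe]
        rcases Nat.lt_succ_iff_lt_or_eq.1 (Finset.mem_range.1 hr) with hr | rfl
        · rw [hzero r hr, Finset.prod_eq_zero (Finset.mem_range.2 hr) (sub_self _), mul_zero]
        · rw [hfact, hκ, div_mul_cancel₀ _ (by positivity)]
    intro s
    rw [hqp, hpe]
  have hq1 : q.eval ((n : ℝ) + 1) = κ * (n + 1).factorial := by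
    rw [hfac, ← hfact (n + 1), Finset.prod_range_succ]
    push_cast; ring
  have hqn : q.eval (n : ℝ) = κ * n.factorial := by
    rw [hκ, div_mul_cancel₀ _ (by positivity)]
  -- the two expressions for the derivative at `n + 1`
  have hd1 : HasDerivAt (fun s => q.eval s) (q.eval ((n : ℝ) + 1) * (harmonic (n + 1) - 1))
      ((n : ℝ) + 1) := by
    have h1 := (hasDerivAt_prod_sub (fun j => (j : ℝ)) n (s := (n : ℝ) + 1) fun j hj => by
      have : (j : ℝ) < n := by exact_mod_cast hj
      linarith).const_mul κ
    simp only [hfac]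
    refine h1.congr_deriv ?_
    rw [mul_assoc]
    congr 2
    rw [harmonic, Finset.sum_range_succ']
    push_cast
    rw [← Finset.sum_range_reflect]
    simp only [inv_one, add_sub_cancel_right]
    refine Finset.sum_congr rfl fun j hj => ?_
    have := Finset.mem_range.1 hj
    rw [Nat.cast_sub (by omega), Nat.cast_sub (by omega), one_div]
    congr 1; push_cast; ring
  have hd2 : HasDerivAt (fun s => q.eval s) (∑ d ∈ Finset.range (n + 1), c d *
      ((∏ j ∈ Finset.range d, ((n : ℝ) + 1 - -((a : ℝ) + 1 + j))) *
        ∑ j ∈ Finset.range d, 1 / ((n : ℝ) + 1 - -((a : ℝ) + 1 + j)))) ((n : ℝ) + 1) := by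
    simp only [hqe]
    refine HasDerivAt.fun_sum fun d _ => HasDerivAt.const_mul _ ?_
    exact hasDerivAt_prod_sub (fun j => -((a : ℝ) + 1 + j)) d fun j _ => by
      rw [sub_neg_eq_add]; positivity
  have hdd := hd1.unique hd2
  calc _ = (a + (n + 1)).factorial * (((harmonic (a + n + 1) : ℝ) - γ) * q.eval ((n : ℝ) + 1) +
        q.eval ((n : ℝ) + 1) * (harmonic (n + 1) - 1)) := by
        rw [hdd, hqe, Finset.mul_sum, ← Finset.sum_add_distrib, Finset.mul_sum]
        refine Finset.sum_congr rfl fun d _ => ?_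
        have e : ∀ j : ℕ, ((a + (n + 1) : ℕ) : ℝ) - -(1 + (j : ℝ)) =
            (n : ℝ) + 1 - -((a : ℝ) + 1 + j) := by
          intro j; push_cast; ring
        rw [factorial_add_eq_prod, harmonic_add_eq_sum]
        simp only [e]
        ring_nf
    _ = _ := by
        rw [hmom n, hq1, hqn, ← add_assoc, Nat.factorial_succ, Nat.factorial_succ]
        push_cast; ring

/-- The average of the divided difference of `t ^ (n + 1) * log t` over the Laguerre ensemble. -/
theorem integral_dividedDiff_pow_log (a n : ℕ) :
    ∫ x, dividedDiff (fun t => t ^ (n + 1) * log t) x * vandermondeProduct x ^ 2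
      ∂(Measure.pi fun _ : Fin (n + 1) => gammaWeight a) =
      (n + 1) * (a + n + 1) *
        ((harmonic (a + n + 1) : ℝ) - eulerMascheroniConstant + harmonic (n + 1) - 1) *
        ∫ x, vandermondeProduct x ^ 2 ∂(Measure.pi fun _ : Fin (n + 1) => gammaWeight a) := by
  have hlog : ∀ e : ℕ, Integrable (fun x => x ^ (n + 1) * log x * x ^ e) (gammaWeight a) := by
    intro e
    refine (integrable_pow_log_gammaWeight a (n + e)).congr (Filter.Eventually.of_forall ?_)
    intro x
    simp only
    ring
  rw [integral_dividedDiff_mul_vandermonde_sq hlog, ← integral_pow_mul_heineIntegral]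
  obtain ⟨c, hc⟩ := exists_polynomial_heineIntegral a n
  have hmom : ∀ r, ∫ u, u ^ r * heineIntegral a n u ∂gammaWeight a =
      ∑ d ∈ Finset.range (n + 1), c d * ((a + r + d).factorial : ℝ) := by
    intro r
    have : ∀ u : ℝ, u ^ r * heineIntegral a n u =
        ∑ d ∈ Finset.range (n + 1), c d * u ^ (r + d) := by
      intro u
      rw [hc, Finset.mul_sum]
      exact Finset.sum_congr rfl fun d _ => by ring
    simp only [this]
    rw [integral_finsetSum _ fun d _ => (integrable_pow_gammaWeight a _).const_mul _]
    simp only [integral_const_mul, integral_pow_gammaWeight, add_assoc]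
  have hlogm : ∫ u, u ^ (n + 1) * log u * heineIntegral a n u ∂gammaWeight a =
      ∑ d ∈ Finset.range (n + 1), c d * (((a + (n + 1) + d).factorial : ℝ) *
        ((harmonic (a + (n + 1) + d) : ℝ) - eulerMascheroniConstant)) := by
    have : ∀ u : ℝ, u ^ (n + 1) * log u * heineIntegral a n u =
        ∑ d ∈ Finset.range (n + 1), c d * (u ^ (n + 1) * log u * u ^ d) := by
      intro u
      rw [hc, Finset.mul_sum]
      exact Finset.sum_congr rfl fun d _ => by ring
    simp only [this]
    rw [integral_finsetSum _ fun d _ => (hlog d).const_mul _]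
    refine Finset.sum_congr rfl fun d _ => ?_
    rw [integral_const_mul, add_assoc, ← integral_pow_log_gammaWeight]
    congr 2; ext u; ring
  rw [hlogm, hmom, log_moment_of_orthogonal a n c _ fun r hr => by
    rw [← hmom, heineIntegral_orthogonal hr]]
  ring

/-! ### The average over the eigenvalue measures -/

/-- The density `Δ(x) ^ 2 ∏ j, x j ^ a` of the eigenvalue measures with integral parameters. -/
noncomputable def laguerreDensity (a : ℕ) {n : ℕ} (x : Fin n → ℝ) : ℝ :=
  vandermondeProduct x ^ 2 * ∏ j, x j ^ a

theorem continuous_laguerreDensity (a n : ℕ) :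
    Continuous (laguerreDensity a : (Fin n → ℝ) → ℝ) := by
  have := continuous_vandermondeProduct n
  unfold laguerreDensity
  fun_prop

theorem laguerreDensity_nonneg {a n : ℕ} {x : Fin n → ℝ} (hx : ∀ i, 0 ≤ x i) :
    0 ≤ laguerreDensity a x :=
  mul_nonneg (sq_nonneg _) (Finset.prod_nonneg fun i _ => pow_nonneg (hx i) _)

theorem laguerreDensity_smul (a k : ℕ) (r : ℝ) (x : Fin (k + 1) → ℝ) :
    laguerreDensity a (r • x) = r ^ ((k + 1) * (k + a)) * laguerreDensity a x := by
  simp only [laguerreDensity, vandermondeProduct_smul_sq, Pi.smul_apply, smul_eq_mul, mul_pow,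
    Finset.prod_mul_distrib, Finset.prod_const, Finset.card_univ, Fintype.card_fin,
    Nat.add_sub_cancel]
  ring

theorem integral_pi_gammaWeight (a : ℕ) {n : ℕ} (f : (Fin n → ℝ) → ℝ) :
    ∫ x, f x ∂(Measure.pi fun _ : Fin n => gammaWeight a) =
      ∫ x, (∏ i, x i ^ a) * f x ∂(Measure.pi fun _ : Fin n => gammaWeight 0) := by
  rw [pi_gammaWeight_eq_withDensity, integral_withDensity_eq_integral_toReal_smul (by fun_prop)
    (by simp)]
  refine integral_congr_ae ?_
  filter_upwards [ae_pi_gammaWeight_pos 0] with x hx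
  rw [ENNReal.toReal_ofReal (Finset.prod_nonneg fun i _ => pow_nonneg (hx i).le _), smul_eq_mul]

theorem integrable_pi_gammaWeight_iff (a : ℕ) {n : ℕ} (f : (Fin n → ℝ) → ℝ) :
    Integrable f (Measure.pi fun _ : Fin n => gammaWeight a) ↔
      Integrable (fun x => (∏ i, x i ^ a) * f x) (Measure.pi fun _ : Fin n => gammaWeight 0) := by
  rw [pi_gammaWeight_eq_withDensity, integrable_withDensity_iff_integrable_smul' (by fun_prop)
    (by simp)]
  refine integrable_congr ?_
  filter_upwards [ae_pi_gammaWeight_pos 0] with x hx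
  rw [ENNReal.toReal_ofReal (Finset.prod_nonneg fun i _ => pow_nonneg (hx i).le _), smul_eq_mul]

theorem measurable_smul_prod (n : ℕ) :
    Measurable fun p : ℝ × (Fin n → ℝ) => p.1 • p.2 := by fun_prop

theorem integrable_simplexMeasure {n : ℕ} {f : (Fin n → ℝ) → ℝ}
    (hf : ContinuousOn f (stdSimplex ℝ (Fin n))) : Integrable f (simplexMeasure n) := by
  have h := hf.integrableOn_compact (μ := simplexMeasure n) (isCompact_stdSimplex ℝ (Fin n))
  rwa [IntegrableOn, Measure.restrict_eq_self_of_ae_mem (ae_simplexMeasure_mem n)] at h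

/-- The total mass of the Laguerre ensemble in terms of that of the simplex. -/
theorem integral_vandermonde_sq (a k : ℕ) :
    ∫ x, vandermondeProduct x ^ 2 ∂(Measure.pi fun _ : Fin (k + 1) => gammaWeight a) =
      (k + (k + 1) * (k + a)).factorial *
        ∫ l, laguerreDensity a l ∂simplexMeasure (k + 1) := by
  have h : ∀ x : Fin (k + 1) → ℝ, (∏ i, x i ^ a) * vandermondeProduct x ^ 2 =
      laguerreDensity a x := fun x => mul_comm _ _
  rw [integral_pi_gammaWeight]
  simp only [h]
  rw [pi_gammaWeight_zero_eq_map, integral_map (measurable_smul_prod _).aemeasurable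
    (continuous_laguerreDensity a _).aestronglyMeasurable]
  simp only [laguerreDensity_smul]
  rw [integral_prod_mul (fun r : ℝ => r ^ ((k + 1) * (k + a))), integral_pow_gammaWeight]

theorem integral_laguerreDensity_pos (a k : ℕ) :
    0 < ∫ l, laguerreDensity a l ∂simplexMeasure (k + 1) := by
  have h : 0 < ∫ x, vandermondeProduct x ^ 2
      ∂(Measure.pi fun _ : Fin (k + 1) => gammaWeight a) := by
    rw [integral_pos_iff_support_of_nonneg (fun x => sq_nonneg _) (integrable_vandermonde_sq a _)]
    -- the Vandermonde product does not vanish on a box with disjoint sides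
    have hsub : univ.pi (fun i : Fin (k + 1) => Ioo (i : ℝ) (i + 1)) ⊆
        Function.support fun x : Fin (k + 1) → ℝ => vandermondeProduct x ^ 2 := by
      intro x hx
      refine pow_ne_zero 2 (vandermondeProduct_ne_zero_iff.2 fun i j hij => ?_)
      have hi := hx i (mem_univ i)
      have hj := hx j (mem_univ j)
      rw [hij] at hi
      have h1 : ((i : ℕ) : ℝ) < (j : ℕ) + 1 := hi.1.trans hj.2
      have h2 : ((j : ℕ) : ℝ) < (i : ℕ) + 1 := hj.1.trans hi.2
      norm_cast at h1 h2
      exact Fin.ext (by omega)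
    refine lt_of_lt_of_le ?_ (measure_mono hsub)
    rw [Measure.pi_pi, pos_iff_ne_zero, Finset.prod_ne_zero_iff]
    intro i _
    rw [gammaWeight, Ne, withDensity_apply_eq_zero (by fun_prop)]
    have hi0 : (0 : ℝ) ≤ (i : ℕ) := Nat.cast_nonneg _
    have : {x : ℝ | ENNReal.ofReal (x ^ a * exp (-x)) ≠ 0} ∩ Ioo ((i : ℕ) : ℝ) ((i : ℕ) + 1) =
        Ioo ((i : ℕ) : ℝ) ((i : ℕ) + 1) := by
      refine inter_eq_right.2 fun x hx => ?_
      have : 0 < x := hi0.trans_lt hx.1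
      simp only [mem_ofPred_eq, ne_eq, ENNReal.ofReal_eq_zero, not_le]
      positivity
    have h0 : Ioo ((i : ℕ) : ℝ) ((i : ℕ) + 1) ∩ Ioi 0 = Ioo ((i : ℕ) : ℝ) ((i : ℕ) + 1) :=
      inter_eq_left.2 fun x hx => hi0.trans_lt hx.1
    rw [this, Measure.restrict_apply measurableSet_Ioo, h0]
    simp
  rw [integral_vandermonde_sq] at h
  exact pos_of_mul_pos_right h (by positivity)

/-- The subentropy of a spectrum appears in the divided difference at its multiple by `r`. -/
theorem dividedDiff_pow_log_smul {k : ℕ} {r : ℝ} (hr : 0 < r) {l : Fin (k + 1) → ℝ}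
    (hl : l ∈ stdSimplex ℝ (Fin (k + 1))) (hi : Function.Injective l) :
    dividedDiff (fun t => t ^ (k + 1) * log t) (r • l) =
      -r * subentropyFormula l + r * log r := by
  have h1 := dividedDiff_pow_card hi
  rw [hl.2] at h1
  rw [subentropyFormula_eq]
  conv_rhs => rw [← mul_one (r * log r), ← h1]
  simp only [dividedDiff, neg_mul_neg, Finset.mul_sum, ← Finset.sum_add_distrib]
  refine Finset.sum_congr rfl fun i _ => ?_
  simp only [Pi.smul_apply, smul_eq_mul, ← mul_sub, Finset.prod_mul_distrib, Finset.prod_const]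
  rw [Finset.card_erase_of_mem (Finset.mem_univ i), Finset.card_univ, Fintype.card_fin,
    Nat.add_sub_cancel]
  have h2 : ∏ j ∈ Finset.univ.erase i, (l i - l j) ≠ 0 :=
    Finset.prod_ne_zero_iff.2 fun j hj => sub_ne_zero.2 (hi.ne (Finset.ne_of_mem_erase hj).symm)
  rcases (hl.1 i).eq_or_lt with h0 | h0
  · simp [← h0]
  · rw [log_mul hr.ne' h0.ne']
    field_simp
    ring

/-- The average of the subentropy for the weight `Δ(x) ^ 2 ∏ j, x j ^ a` on the simplex. -/
theorem integral_spectralSubentropy_mul_laguerreDensity (a k : ℕ) :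
    ∫ l, spectralSubentropy l * laguerreDensity a l ∂simplexMeasure (k + 1) =
      (1 + harmonic ((k + 1) * (k + 1 + a)) - harmonic (k + 1) - harmonic (k + 1 + a)) *
        ∫ l, laguerreDensity a l ∂simplexMeasure (k + 1) := by
  set g : ℝ → ℝ := fun t => t ^ (k + 1) * log t with hg
  have hlog : ∀ e : ℕ, Integrable (fun x => g x * x ^ e) (gammaWeight a) := by
    intro e
    refine (integrable_pow_log_gammaWeight a (k + e)).congr (Filter.Eventually.of_forall ?_)
    intro x
    simp only [hg]
    ring
  set e := (k + 1) * (k + a) with he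
  have hint := integrable_dividedDiff_mul_vandermonde_sq (n := k) hlog
  rw [integrable_pi_gammaWeight_iff, pi_gammaWeight_zero_eq_map] at hint
  have hQ : Integrable (fun l => spectralSubentropy l * laguerreDensity a l)
      (simplexMeasure (k + 1)) := integrable_simplexMeasure
    ((continuousOn_spectralSubentropy _).mul (continuous_laguerreDensity a _).continuousOn)
  have hN : Integrable (laguerreDensity a) (simplexMeasure (k + 1)) :=
    integrable_simplexMeasure (continuous_laguerreDensity a _).continuousOn
  have hr1 : Integrable (fun r : ℝ => r ^ (e + 1)) (gammaWeight k) :=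
    integrable_pow_gammaWeight k _
  have hr2 : Integrable (fun r : ℝ => r ^ (e + 1) * log r) (gammaWeight k) :=
    integrable_pow_log_gammaWeight k _
  have hI : Integrable (fun p : ℝ × (Fin (k + 1) → ℝ) =>
      -(p.1 ^ (e + 1) * (spectralSubentropy p.2 * laguerreDensity a p.2)))
      ((gammaWeight k).prod (simplexMeasure (k + 1))) := (hr1.mul_prod hQ).neg
  have key : ∫ x, dividedDiff g x * vandermondeProduct x ^ 2
      ∂(Measure.pi fun _ : Fin (k + 1) => gammaWeight a) =
      -((k + (e + 1)).factorial *
        ∫ l, spectralSubentropy l * laguerreDensity a l ∂simplexMeasure (k + 1)) +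
      (k + (e + 1)).factorial * ((harmonic (k + (e + 1)) : ℝ) - eulerMascheroniConstant) *
        ∫ l, laguerreDensity a l ∂simplexMeasure (k + 1) := by
    rw [integral_pi_gammaWeight, pi_gammaWeight_zero_eq_map,
      integral_map (measurable_smul_prod _).aemeasurable hint.aestronglyMeasurable,
      ← integral_pow_log_gammaWeight, ← integral_pow_gammaWeight, ← integral_prod_mul,
      ← integral_prod_mul, ← integral_neg, ← integral_add hI (hr2.mul_prod hN)]
    refine integral_congr_ae ?_
    have hpos : ∀ᵐ p ∂(gammaWeight k).prod (simplexMeasure (k + 1)), 0 < p.1 :=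
      Measure.quasiMeasurePreserving_fst.ae (ae_gammaWeight_pos k)
    have hmem : ∀ᵐ p ∂(gammaWeight k).prod (simplexMeasure (k + 1)),
        p.2 ∈ stdSimplex ℝ (Fin (k + 1)) :=
      Measure.quasiMeasurePreserving_snd.ae (ae_simplexMeasure_mem (k + 1))
    filter_upwards [hpos, hmem] with p h1 h2
    have h3 : (∏ i, (p.1 • p.2) i ^ a) *
        (dividedDiff g (p.1 • p.2) * vandermondeProduct (p.1 • p.2) ^ 2) =
        dividedDiff g (p.1 • p.2) * (p.1 ^ e * laguerreDensity a p.2) := by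
      rw [he, ← laguerreDensity_smul, laguerreDensity]; ring
    rw [h3]
    by_cases hi : Function.Injective p.2
    · rw [dividedDiff_pow_log_smul h1 h2 hi, spectralSubentropy_eq_formula h2 hi]
      ring
    · have : laguerreDensity a p.2 = 0 := by
        rw [laguerreDensity, not_not.1 (mt vandermondeProduct_ne_zero_iff.1 hi)]; simp
      simp [this]
  have h1 := integral_dividedDiff_pow_log a k
  rw [key, integral_vandermonde_sq] at h1
  have hk : k + (e + 1) = (k + 1) * (k + 1 + a) := by rw [he]; ring
  have hf : ((k + (e + 1)).factorial : ℝ) =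
      (k + 1) * (a + k + 1) * (k + e).factorial := by
    have : k + (e + 1) = (k + e) + 1 := by ring
    rw [this, Nat.factorial_succ, ← this, hk]
    push_cast; ring
  have hfpos : ((k + (e + 1)).factorial : ℝ) ≠ 0 := by positivity
  have hak : a + k + 1 = k + 1 + a := by ring
  rw [hk] at h1
  refine mul_left_cancel₀ hfpos ?_
  rw [hak] at h1
  rw [hk] at hf ⊢
  rw [← he] at h1
  have h2 : ((k : ℝ) + 1) * (a + k + 1) *
      (harmonic (k + 1 + a) - eulerMascheroniConstant + harmonic (k + 1) - 1) *
      ((k + e).factorial * ∫ l, laguerreDensity a l ∂simplexMeasure (k + 1)) =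
      ((k + 1) * (k + 1 + a)).factorial *
      ((harmonic (k + 1 + a) - eulerMascheroniConstant + harmonic (k + 1) - 1) *
        ∫ l, laguerreDensity a l ∂simplexMeasure (k + 1)) := by
    rw [hf]; ring
  rw [h2] at h1
  linear_combination -h1

theorem eigenvalueWeight_eq (m n : ℕ) (hmn : m ≤ n) :
    eigenvalueWeight m ((n : ℝ) - m + 1) 1 =
      (simplexMeasure m).withDensity fun x => ENNReal.ofReal (laguerreDensity (n - m) x) := by
  refine withDensity_congr_ae ?_
  filter_upwards [ae_simplexMeasure_mem m] with x hx
  have h1 : |vandermondeProduct x| ^ (2 * (1 : ℝ)) = vandermondeProduct x ^ 2 := by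
    rw [mul_one, ← sq_abs, ← rpow_natCast]; norm_num
  have h2 : ∀ j, x j ^ ((n : ℝ) - m + 1 - 1) = x j ^ (n - m) := by
    intro j
    rw [add_sub_cancel_right, ← Nat.cast_sub hmn, rpow_natCast]
  simp only [h1, h2, laguerreDensity]

/-- The average of the subentropy over the eigenvalue measure with `γ = 1`. -/
theorem averageSubentropy_eq {m n : ℕ} (hm : 1 ≤ m) (hmn : m ≤ n) :
    Integrable spectralSubentropy (eigenvalueMeasure m ((n : ℝ) - m + 1) 1) ∧
      averageSubentropy m ((n : ℝ) - m + 1) 1 =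
        1 + (harmonic (m * n) : ℝ) - harmonic m - harmonic n := by
  obtain ⟨k, rfl⟩ : ∃ k, m = k + 1 := ⟨m - 1, by omega⟩
  obtain ⟨a, rfl⟩ : ∃ a, n = k + 1 + a := ⟨n - (k + 1), by omega⟩
  rw [averageSubentropy, eigenvalueMeasure, eigenvalueWeight_eq _ _ hmn, Nat.add_sub_cancel_left]
  have hN : Integrable (laguerreDensity a) (simplexMeasure (k + 1)) :=
    integrable_simplexMeasure (continuous_laguerreDensity a _).continuousOn
  have hQ : Integrable (fun l => spectralSubentropy l * laguerreDensity a l)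
      (simplexMeasure (k + 1)) := integrable_simplexMeasure
    ((continuousOn_spectralSubentropy _).mul (continuous_laguerreDensity a _).continuousOn)
  have h0 : 0 ≤ᵐ[simplexMeasure (k + 1)] laguerreDensity a := by
    filter_upwards [ae_simplexMeasure_mem (k + 1)] with x hx using laguerreDensity_nonneg hx.1
  have hpos := integral_laguerreDensity_pos a k
  have hm' : Measurable fun x : Fin (k + 1) → ℝ => ENNReal.ofReal (laguerreDensity a x) :=
    (continuous_laguerreDensity a _).measurable.ennreal_ofReal
  have hsmul : ∀ x : Fin (k + 1) → ℝ, x ∈ stdSimplex ℝ (Fin (k + 1)) →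
      (ENNReal.ofReal (laguerreDensity a x)).toReal • spectralSubentropy x =
        spectralSubentropy x * laguerreDensity a x := by
    intro x hx
    rw [ENNReal.toReal_ofReal (laguerreDensity_nonneg hx.1), smul_eq_mul, mul_comm]
  rw [withDensity_apply _ MeasurableSet.univ, Measure.restrict_univ,
    ← ofReal_integral_eq_lintegral_ofReal hN h0]
  constructor
  · refine Integrable.smul_measure ?_ (by simpa using hpos)
    rw [integrable_withDensity_iff_integrable_smul' hm' (by simp)]
    refine hQ.congr ?_
    filter_upwards [ae_simplexMeasure_mem (k + 1)] with x hx using (hsmul x hx).symm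
  · rw [integral_smul_measure, integral_withDensity_eq_integral_toReal_smul hm' (by simp)]
    have h1 : ∫ x, (ENNReal.ofReal (laguerreDensity a x)).toReal • spectralSubentropy x
        ∂simplexMeasure (k + 1) =
        ∫ x, spectralSubentropy x * laguerreDensity a x ∂simplexMeasure (k + 1) := by
      refine integral_congr_ae ?_
      filter_upwards [ae_simplexMeasure_mem (k + 1)] with x hx using hsmul x hx
    rw [h1, integral_spectralSubentropy_mul_laguerreDensity, ENNReal.toReal_inv,
      ENNReal.toReal_ofReal hpos.le, smul_eq_mul]
    field_simp

/-! ### Complex Gaussian vectors -/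

/-- Polar coordinates for the unnormalized Gaussian measure in even dimension: the squared norm
is Gamma distributed, and independent of the uniformly distributed direction. -/
theorem withDensity_gaussian_eq_map {E : Type*} [NormedAddCommGroup E] [NormedSpace ℝ E]
    [FiniteDimensional ℝ E] [MeasurableSpace E] [BorelSpace E] (μ : Measure E)
    [μ.IsAddHaarMeasure] {k : ℕ} (hE : Module.finrank ℝ E = 2 * (k + 1)) :
    μ.withDensity (fun x => ENNReal.ofReal (exp (-‖x‖ ^ 2))) =
      ((gammaWeight k).prod ((2 : ENNReal)⁻¹ • μ.toSphere)).map fun p => √p.1 • (p.2 : E) := by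
  have : Nontrivial E := Module.nontrivial_of_finrank_pos (R := ℝ) (by omega)
  have hmap : Measurable fun p : ℝ × Metric.sphere (0 : E) 1 => √p.1 • (p.2 : E) := by fun_prop
  have hfin : IsFiniteMeasure ((2 : ENNReal)⁻¹ • μ.toSphere) :=
    Measure.smul_finite _ (by simp)
  refine Measure.ext_of_lintegral _ fun F hF => ?_
  have hFmap : Measurable fun p : ℝ × Metric.sphere (0 : E) 1 => F (√p.1 • (p.2 : E)) :=
    hF.comp hmap
  have hG : Measurable fun x : E => ENNReal.ofReal (exp (-‖x‖ ^ 2)) * F x := by fun_prop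
  have hG' : ∀ ω : Metric.sphere (0 : E) 1, Measurable fun r : ℝ =>
      ENNReal.ofReal (exp (-‖r • (ω : E)‖ ^ 2)) * F (r • (ω : E)) := fun ω =>
    hG.comp (measurable_id.smul_const _)
  have hL : ∫⁻ x, F x ∂μ.withDensity (fun x => ENNReal.ofReal (exp (-‖x‖ ^ 2))) =
      ∫⁻ ω, (∫⁻ r in Ioi (0 : ℝ), ENNReal.ofReal (r ^ (2 * k + 1)) *
        (ENNReal.ofReal (exp (-‖r • (ω : E)‖ ^ 2)) * F (r • (ω : E)))) ∂μ.toSphere := by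
    rw [lintegral_withDensity_eq_lintegral_mul _ (by fun_prop) hF]
    calc ∫⁻ x, ENNReal.ofReal (exp (-‖x‖ ^ 2)) * F x ∂μ
        = ∫⁻ x : ({(0 : E)}ᶜ : Set E), ENNReal.ofReal (exp (-‖(x : E)‖ ^ 2)) * F x
            ∂(μ.comap (↑)) := by
          rw [lintegral_subtype_comap (measurableSet_singleton _).compl
            fun x => ENNReal.ofReal (exp (-‖x‖ ^ 2)) * F x, restrict_compl_singleton]
      _ = ∫⁻ p : Metric.sphere (0 : E) 1 × Ioi (0 : ℝ),
            ENNReal.ofReal (exp (-‖(p.2 : ℝ) • (p.1 : E)‖ ^ 2)) * F ((p.2 : ℝ) • (p.1 : E))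
            ∂(μ.toSphere.prod (.volumeIoiPow (Module.finrank ℝ E - 1))) := by
          rw [← μ.measurePreserving_homeomorphUnitSphereProd.symm
            (homeomorphUnitSphereProd E).toMeasurableEquiv |>.lintegral_comp_emb
            (MeasurableEquiv.measurableEmbedding _)]
          rfl
      _ = _ := by
          rw [lintegral_prod _ (by fun_prop)]
          refine lintegral_congr fun ω => ?_
          rw [Measure.volumeIoiPow, lintegral_withDensity_eq_lintegral_mul _ (by fun_prop)
            (g := fun r : Ioi (0 : ℝ) =>
              ENNReal.ofReal (exp (-‖(r : ℝ) • (ω : E)‖ ^ 2)) * F ((r : ℝ) • (ω : E)))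
            ((hG' ω).comp measurable_subtype_coe), hE]
          exact lintegral_subtype_comap measurableSet_Ioi fun r : ℝ =>
            ENNReal.ofReal (r ^ (2 * k + 1)) *
              (ENNReal.ofReal (exp (-‖r • (ω : E)‖ ^ 2)) * F (r • (ω : E)))
  rw [hL, lintegral_map hF hmap, lintegral_prod_symm _ hFmap.aemeasurable,
    lintegral_smul_measure, smul_eq_mul, ← lintegral_const_mul' _ _ (by simp)]
  refine lintegral_congr fun ω => ?_
  have hω : ‖(ω : E)‖ = 1 := mem_sphere_zero_iff_norm.1 ω.2
  rw [gammaWeight, lintegral_withDensity_eq_lintegral_mul _ (by fun_prop)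
    (g := fun u : ℝ => F (√u • (ω : E))) (hFmap.comp (measurable_id.prodMk measurable_const))]
  have himg : (fun r : ℝ => r ^ 2) '' Ioi 0 = Ioi 0 := by
    ext u
    constructor
    · rintro ⟨r, hr, rfl⟩
      exact pow_pos (mem_Ioi.1 hr) 2
    · intro hu
      exact ⟨√u, sqrt_pos.2 hu, sq_sqrt (le_of_lt hu)⟩
  have hinj : InjOn (fun r : ℝ => r ^ 2) (Ioi 0) := fun a ha b hb hab =>
    (pow_left_inj₀ (le_of_lt ha) (le_of_lt hb) two_ne_zero).1 hab
  have hcv := lintegral_image_eq_lintegral_abs_deriv_mul (s := Ioi (0 : ℝ))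
    (f := fun r : ℝ => r ^ 2) (f' := fun r => 2 * r) measurableSet_Ioi
    (fun r _ => by simpa using (hasDerivAt_pow 2 r).hasDerivWithinAt) hinj
    (fun u => ENNReal.ofReal (u ^ k * exp (-u)) * F (√u • (ω : E)))
  rw [himg] at hcv
  simp only [Pi.mul_apply]
  rw [hcv, ← lintegral_const_mul' _ _ (by simp)]
  refine setLIntegral_congr_fun measurableSet_Ioi fun r hr => ?_
  have hr' : (0 : ℝ) < r := hr
  rw [norm_smul, hω, mul_one, norm_of_nonneg hr'.le, sqrt_sq hr'.le, abs_of_pos (by positivity)]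
  rw [ENNReal.ofReal_mul (by positivity : (0 : ℝ) ≤ 2), ENNReal.ofReal_ofNat, ← mul_assoc,
    ← mul_assoc, ← mul_assoc, ← mul_assoc, ENNReal.inv_mul_cancel (by simp) (by simp), one_mul,
    ← ENNReal.ofReal_mul (by positivity), ← ENNReal.ofReal_mul (by positivity)]
  congr 2
  ring

/-- The standard complex Gaussian distribution, with density `π⁻¹ * exp (-‖z‖ ^ 2)`. -/
noncomputable def complexGaussian : Measure ℂ :=
  volume.withDensity fun z => ENNReal.ofReal (π⁻¹ * exp (-‖z‖ ^ 2))

theorem complexGaussian_eq_smul :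
    complexGaussian = ENNReal.ofReal π⁻¹ •
      (volume : Measure ℂ).withDensity fun z => ENNReal.ofReal (exp (-‖z‖ ^ 2)) := by
  rw [← withDensity_smul _ (by fun_prop), complexGaussian]
  congr 1
  ext z
  rw [ENNReal.ofReal_mul (by positivity)]
  rfl

/-- The squared modulus of a standard complex Gaussian is exponentially distributed. -/
theorem map_norm_sq_complexGaussian :
    complexGaussian.map (fun z => ‖z‖ ^ 2) = gammaWeight 0 := by
  have hmap : Measurable fun p : ℝ × Metric.sphere (0 : ℂ) 1 => √p.1 • (p.2 : ℂ) := by fun_prop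
  have hfin : IsFiniteMeasure ((2 : ENNReal)⁻¹ • (volume : Measure ℂ).toSphere) :=
    Measure.smul_finite (volume : Measure ℂ).toSphere (by simp)
  rw [complexGaussian_eq_smul, withDensity_gaussian_eq_map (k := 0) _
    (by rw [Complex.finrank_real_complex]), Measure.map_smul,
    Measure.map_map (by fun_prop) hmap]
  have h1 : Measure.map ((fun z : ℂ => ‖z‖ ^ 2) ∘
      fun p : ℝ × Metric.sphere (0 : ℂ) 1 => √p.1 • (p.2 : ℂ))
      ((gammaWeight 0).prod ((2 : ENNReal)⁻¹ • (volume : Measure ℂ).toSphere)) =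
      Measure.map Prod.fst
        ((gammaWeight 0).prod ((2 : ENNReal)⁻¹ • (volume : Measure ℂ).toSphere)) := by
    refine Measure.map_congr ?_
    have hpos : ∀ᵐ p ∂(gammaWeight 0).prod ((2 : ENNReal)⁻¹ • (volume : Measure ℂ).toSphere),
        0 < p.1 := Measure.quasiMeasurePreserving_fst.ae (ae_gammaWeight_pos 0)
    filter_upwards [hpos] with p hp
    have : ‖(p.2 : ℂ)‖ = 1 := mem_sphere_zero_iff_norm.1 p.2.2
    simp only [Function.comp]
    rw [norm_smul, this, mul_one, norm_of_nonneg (sqrt_nonneg _), sq_sqrt hp.le]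
  rw [h1, Measure.map_fst_prod, Measure.smul_apply, Measure.toSphere_apply_univ,
    Complex.finrank_real_complex, Complex.volume_ball, smul_smul]
  have h2 : ENNReal.ofReal π⁻¹ * ((2 : ENNReal)⁻¹ • (((2 : ℕ) : ENNReal) *
      (ENNReal.ofReal 1 ^ 2 * (NNReal.pi : ENNReal)))) = 1 := by
    have h3 : (NNReal.pi : ENNReal) = ENNReal.ofReal π := by
      rw [ENNReal.ofReal, ENNReal.coe_inj]
      exact (Real.toNNReal_of_nonneg pi_pos.le).symm
    rw [h3, smul_eq_mul, ← mul_assoc (2 : ENNReal)⁻¹, Nat.cast_ofNat,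
      ENNReal.inv_mul_cancel (by simp) (by simp), ENNReal.ofReal_one, one_pow, one_mul, one_mul,
      ← ENNReal.ofReal_mul (by positivity), inv_mul_cancel₀ pi_pos.ne', ENNReal.ofReal_one]
  rw [h2, one_smul]

instance : IsProbabilityMeasure complexGaussian := by
  have h : IsProbabilityMeasure (complexGaussian.map fun z => ‖z‖ ^ 2) := by
    rw [map_norm_sq_complexGaussian]; infer_instance
  exact ⟨by rw [← h.measure_univ, Measure.map_apply (by fun_prop) MeasurableSet.univ, preimage_univ]⟩

theorem map_norm_sq_pi_complexGaussian {ι : Type*} [Fintype ι] :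
    (Measure.pi fun _ : ι => complexGaussian).map (fun z i => ‖z i‖ ^ 2) =
      Measure.pi fun _ : ι => gammaWeight 0 := by
  have : SigmaFinite (complexGaussian.map fun z => ‖z‖ ^ 2) := by
    rw [map_norm_sq_complexGaussian]; infer_instance
  rw [Measure.pi_map_pi (f := fun _ (z : ℂ) => ‖z‖ ^ 2) fun _ => by fun_prop,
    map_norm_sq_complexGaussian]

/-- The standard Gaussian distribution on `ℂ^ι`. -/
noncomputable def gaussianVector (ι : Type*) [Fintype ι] : Measure (EuclideanSpace ℂ ι) :=
  (Measure.pi fun _ : ι => complexGaussian).map (WithLp.toLp 2)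

theorem measurable_toLp_complex (ι : Type*) [Fintype ι] :
    Measurable (WithLp.toLp 2 : (ι → ℂ) → EuclideanSpace ℂ ι) := by fun_prop

instance (ι : Type*) [Fintype ι] : IsProbabilityMeasure (gaussianVector ι) :=
  Measure.isProbabilityMeasure_map (measurable_toLp_complex ι).aemeasurable

/-- The Gaussian distribution is a multiple of `exp (-‖x‖ ^ 2) dx`. -/
theorem exists_gaussianVector_eq_smul (ι : Type*) [Fintype ι] :
    ∃ c : ENNReal, gaussianVector ι =
      c • (volume : Measure (EuclideanSpace ℂ ι)).withDensity
        fun x => ENNReal.ofReal (exp (-‖x‖ ^ 2)) := by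
  have hm := measurable_toLp_complex ι
  have hhaar : ((volume : Measure (ι → ℂ)).map
      (WithLp.toLp 2 : (ι → ℂ) → EuclideanSpace ℂ ι)).IsAddHaarMeasure :=
    (PiLp.continuousLinearEquiv 2 ℝ (fun _ : ι => ℂ)).symm.isAddHaarMeasure_map volume
  obtain ⟨c, hc⟩ : ∃ c : NNReal, (volume : Measure (ι → ℂ)).map
      (WithLp.toLp 2 : (ι → ℂ) → EuclideanSpace ℂ ι) = c • volume :=
    ⟨_, Measure.isAddLeftInvariant_eq_smul _ _⟩
  have hpi : Measure.pi (fun _ : ι => complexGaussian) =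
      (volume : Measure (ι → ℂ)).withDensity
        fun x => ENNReal.ofReal (∏ i, (π⁻¹ * exp (-‖x i‖ ^ 2))) := by
    rw [volume_pi, ← pi_withDensity_ofReal (volume : Measure ℂ)
      (f := fun z => π⁻¹ * exp (-‖z‖ ^ 2))]
    · rfl
    · have h1 : IsFiniteMeasure complexGaussian := inferInstance
      have h2 := h1.measure_univ_lt_top
      rw [complexGaussian, withDensity_apply _ MeasurableSet.univ, Measure.restrict_univ] at h2
      exact ⟨by fun_prop, (hasFiniteIntegral_iff_ofReal
        (Filter.Eventually.of_forall fun z => by positivity)).2 h2⟩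
    · exact Filter.Eventually.of_forall fun z => by positivity
  refine ⟨ENNReal.ofReal (π⁻¹ ^ Fintype.card ι) * c, ?_⟩
  refine Measure.ext_of_lintegral _ fun F hF => ?_
  have hF2 : Measurable fun x : EuclideanSpace ℂ ι => ENNReal.ofReal (exp (-‖x‖ ^ 2)) * F x := by
    fun_prop
  rw [gaussianVector, lintegral_map hF hm, hpi, lintegral_withDensity_eq_lintegral_mul _
    (by fun_prop) (g := fun x : ι → ℂ => F (WithLp.toLp 2 x)) (hF.comp hm), lintegral_smul_measure,
    lintegral_withDensity_eq_lintegral_mul _ (by fun_prop) hF]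
  have hprod : ∀ x : ι → ℂ, ENNReal.ofReal (∏ i, (π⁻¹ * exp (-‖x i‖ ^ 2))) *
      F (WithLp.toLp 2 x) = ENNReal.ofReal (π⁻¹ ^ Fintype.card ι) *
        (ENNReal.ofReal (exp (-‖(WithLp.toLp 2 x : EuclideanSpace ℂ ι)‖ ^ 2)) *
          F (WithLp.toLp 2 x)) := by
    intro x
    rw [← mul_assoc, ← ENNReal.ofReal_mul (by positivity), EuclideanSpace.norm_sq_eq,
      Finset.prod_mul_distrib, ← exp_sum, Finset.sum_neg_distrib]
    simp
  simp only [Pi.mul_apply, hprod]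
  rw [lintegral_const_mul' _ _ (by simp), ← lintegral_map (f := fun x : EuclideanSpace ℂ ι =>
    ENNReal.ofReal (exp (-‖x‖ ^ 2)) * F x) hF2 hm, hc]
  rw [lintegral_smul_measure, smul_eq_mul, mul_assoc]
  rfl

/-- The Gaussian distribution is invariant under unitary transformations. -/
theorem map_gaussianVector {ι : Type*} [Fintype ι]
    (e : EuclideanSpace ℂ ι ≃ₗᵢ[ℂ] EuclideanSpace ℂ ι) :
    (gaussianVector ι).map e = gaussianVector ι := by
  obtain ⟨c, hc⟩ := exists_gaussianVector_eq_smul ι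
  let e' : EuclideanSpace ℂ ι ≃ₗᵢ[ℝ] EuclideanSpace ℂ ι :=
    { e.toLinearEquiv.restrictScalars ℝ with norm_map' := e.norm_map }
  have he : MeasurePreserving e volume volume := e'.measurePreserving
  rw [hc, Measure.map_smul]
  congr 1
  refine Measure.ext_of_lintegral _ fun F hF => ?_
  have hFe : Measurable fun x => F (e x) := hF.comp he.measurable
  rw [lintegral_map hF he.measurable,
    lintegral_withDensity_eq_lintegral_mul _ (by fun_prop) hFe,
    lintegral_withDensity_eq_lintegral_mul _ (by fun_prop) hF]
  have h := he.lintegral_comp (f := fun x => ENNReal.ofReal (exp (-‖x‖ ^ 2)) * F x) (by fun_prop)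
  simpa only [Pi.mul_apply, e.norm_map] using h

/-- The squared moduli of the coordinates of a Gaussian vector in any orthonormal basis are
independent and exponentially distributed. -/
theorem map_norm_sq_repr_gaussianVector {ι : Type*} [Fintype ι]
    (b : OrthonormalBasis ι ℂ (EuclideanSpace ℂ ι)) :
    (gaussianVector ι).map (fun z i => ‖b.repr z i‖ ^ 2) = Measure.pi fun _ : ι => gammaWeight 0 := by
  have h1 : Measurable fun (z : EuclideanSpace ℂ ι) (i : ι) => ‖z i‖ ^ 2 := by fun_prop
  have h2 : Measurable (b.repr : EuclideanSpace ℂ ι → EuclideanSpace ℂ ι) :=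
    b.repr.continuous.measurable
  have h3 : (fun (z : EuclideanSpace ℂ ι) (i : ι) => ‖b.repr z i‖ ^ 2) =
      (fun (z : EuclideanSpace ℂ ι) (i : ι) => ‖z i‖ ^ 2) ∘ b.repr := rfl
  rw [h3, ← Measure.map_map h1 h2, map_gaussianVector, gaussianVector,
    Measure.map_map h1 (measurable_toLp_complex ι), ← map_norm_sq_pi_complexGaussian]
  rfl

/-- The squared modulus of the inner product with a fixed vector is exponentially distributed. -/
theorem map_norm_sq_inner_gaussianVector {ι : Type*} [Fintype ι] [DecidableEq ι]
    (w : EuclideanSpace ℂ ι) :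
    (gaussianVector ι).map (fun g => ‖inner ℂ w g‖ ^ 2) =
      (gammaWeight 0).map fun t => ‖w‖ ^ 2 * t := by
  rcases eq_or_ne w 0 with rfl | hw
  · simp [Measure.map_const]
  have hw' : ‖w‖ ≠ 0 := norm_ne_zero_iff.2 hw
  -- `w / ‖w‖` is the first vector of some orthonormal basis
  have hne : Nonempty ι := by
    by_contra hne
    rw [not_nonempty_iff] at hne
    exact hw (Subsingleton.elim _ _)
  obtain ⟨i₀⟩ := hne
  set u : EuclideanSpace ℂ ι := ((‖w‖ : ℂ)⁻¹) • w with hu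
  have hunit : ‖u‖ = 1 := by
    rw [hu, norm_smul, norm_inv, Complex.norm_real, norm_norm, inv_mul_cancel₀ hw']
  have hon : Orthonormal ℂ (({i₀} : Set ι).domRestrict fun _ => u) :=
    ⟨fun _ => hunit, fun i j hij => absurd (Subsingleton.elim i j) hij⟩
  obtain ⟨b, hb⟩ := hon.exists_orthonormalBasis_extension_of_card_eq (by simp)
  have hb0 : b i₀ = u := hb i₀ rfl
  have hwu : w = (‖w‖ : ℂ) • u := by
    rw [hu, smul_smul, mul_inv_cancel₀ (by exact_mod_cast hw'), one_smul]
  have h1 : (fun g => ‖inner ℂ w g‖ ^ 2) =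
      (fun x : ι → ℝ => ‖w‖ ^ 2 * x i₀) ∘ fun (z : EuclideanSpace ℂ ι) i => ‖b.repr z i‖ ^ 2 := by
    ext g
    simp only [Function.comp, b.repr_apply_apply, hb0]
    conv_lhs => rw [hwu]
    rw [inner_smul_left, norm_mul, mul_pow, RCLike.norm_conj, Complex.norm_real, norm_norm]
  have h2 : Measurable fun (z : EuclideanSpace ℂ ι) i => ‖b.repr z i‖ ^ 2 := by
    have := b.repr.continuous
    exact Continuous.measurable (by fun_prop)
  rw [h1, ← Measure.map_map (by fun_prop) h2, map_norm_sq_repr_gaussianVector]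
  have h3 : (fun x : ι → ℝ => ‖w‖ ^ 2 * x i₀) = (fun t => ‖w‖ ^ 2 * t) ∘ Function.eval i₀ := rfl
  rw [h3, ← Measure.map_map (by fun_prop) (by fun_prop), Measure.pi_map_eval]
  simp

/-! ### Density matrices as quadratic forms in a Gaussian vector -/

/-- The value `⟨z, M z⟩` of the quadratic form of a Hermitian matrix `M`. The real part is taken, which
loses nothing as the value is real. -/
noncomputable def quadForm {ι : Type*} [Fintype ι] (M : Matrix ι ι ℂ) (z : EuclideanSpace ℂ ι) : ℝ :=
  (star z.ofLp ⬝ᵥ M.mulVec z.ofLp).re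

theorem Matrix.IsHermitian.quadForm_eq {ι : Type*} [Fintype ι] [DecidableEq ι] {M : Matrix ι ι ℂ}
    (hM : M.IsHermitian) (z : EuclideanSpace ℂ ι) :
    quadForm M z = ∑ i, hM.eigenvalues i * ‖hM.eigenvectorBasis.repr z i‖ ^ 2 := by
  set b := hM.eigenvectorBasis with hb
  have hT : (Matrix.toEuclideanLin M).IsSymmetric := Matrix.isSymmetric_toEuclideanLin_iff.2 hM
  have h1 : star z.ofLp ⬝ᵥ M.mulVec z.ofLp = inner ℂ z (Matrix.toEuclideanLin M z) := by
    rw [EuclideanSpace.inner_eq_star_dotProduct, dotProduct_comm]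
    rfl
  have h2 : ∀ i, Matrix.toEuclideanLin M (b i) = (hM.eigenvalues i : ℂ) • b i := by
    intro i
    ext j
    have := congrFun (hM.mulVec_eigenvectorBasis i) j
    simpa using this
  rw [quadForm, h1, ← b.sum_inner_mul_inner, Complex.re_sum]
  refine Finset.sum_congr rfl fun i _ => ?_
  rw [← hT, h2, inner_smul_left, Complex.conj_ofReal, b.repr_apply_apply, mul_left_comm,
    Complex.re_ofReal_mul, ← inner_conj_symm z (b i), Complex.conj_mul']
  norm_cast

theorem DensityMatrix.spectrum_mem {m : ℕ} (ρ : DensityMatrix m) :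
    ρ.spectrum ∈ stdSimplex ℝ (Fin m) := by
  refine ⟨fun i => ρ.2.1.eigenvalues_nonneg i, ?_⟩
  have h := ρ.2.1.isHermitian.trace_eq_sum_eigenvalues
  have h2 : ((∑ i, ρ.spectrum i : ℝ) : ℂ) = 1 := by
    rw [Complex.ofReal_sum]
    exact h.symm.trans ρ.2.2
  exact_mod_cast h2

theorem measurable_quadForm {ι : Type*} [Fintype ι] (M : Matrix ι ι ℂ) :
    Measurable (quadForm M) := by
  unfold quadForm
  exact Continuous.measurable (by fun_prop)

/-- The form `⟨z, ρ z⟩` of a Gaussian vector `z` has the distribution of the average of independent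
exponential variables weighted by the eigenvalues of `ρ`. -/
theorem DensityMatrix.map_quadForm {m : ℕ} (ρ : DensityMatrix m) :
    (gaussianVector (Fin m)).map (quadForm ρ.1) =
      (Measure.pi fun _ : Fin m => gammaWeight 0).map fun y => ∑ i, ρ.spectrum i * y i := by
  have h2 : Continuous fun (z : EuclideanSpace ℂ (Fin m)) i =>
      ‖ρ.2.1.isHermitian.eigenvectorBasis.repr z i‖ ^ 2 := by
    have := ρ.2.1.isHermitian.eigenvectorBasis.repr.continuous
    fun_prop
  rw [← map_norm_sq_repr_gaussianVector ρ.2.1.isHermitian.eigenvectorBasis,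
    Measure.map_map (by fun_prop) h2.measurable]
  exact congrArg (fun f => Measure.map f _) (funext fun z => ρ.2.1.isHermitian.quadForm_eq z)

theorem DensityMatrix.integral_comp_quadForm {m : ℕ} (ρ : DensityMatrix m) {f : ℝ → ℝ}
    (hf : Continuous f) :
    ∫ z, f (quadForm ρ.1 z) ∂gaussianVector (Fin m) =
      ∫ y, f (∑ i, ρ.spectrum i * y i) ∂(Measure.pi fun _ : Fin m => gammaWeight 0) := by
  rw [← integral_map (measurable_quadForm _).aemeasurable hf.aestronglyMeasurable, ρ.map_quadForm,
    integral_map (Continuous.aemeasurable (by fun_prop)) hf.aestronglyMeasurable]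

theorem HasQuadraticGrowth.integrable_quadForm {m : ℕ} {φ : ℝ → ℝ} (hφ : HasQuadraticGrowth φ)
    (ρ : DensityMatrix m) : Integrable (fun z => φ (quadForm ρ.1 z)) (gaussianVector (Fin m)) := by
  have h := hφ.integrable_sum ρ.spectrum 0
  simp only [zero_add] at h
  have h2 : Integrable φ ((gaussianVector (Fin m)).map (quadForm ρ.1)) := by
    rw [ρ.map_quadForm]
    exact (integrable_map_measure hφ.1.aestronglyMeasurable
      (Continuous.aemeasurable (by fun_prop))).2 h
  exact h2.comp_measurable (measurable_quadForm _)

theorem DensityMatrix.integral_quadForm {m : ℕ} (ρ : DensityMatrix m) :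
    ∫ z, quadForm ρ.1 z ∂gaussianVector (Fin m) = 1 := by
  have h := ρ.integral_comp_quadForm continuous_id
  simp only [id] at h
  rw [h, integral_sum_mul_pi_gammaWeight, ρ.spectrum_mem.2]

/-- The subentropy as a Gaussian average, in which no eigenvalues appear. -/
theorem DensityMatrix.subentropy_eq {m : ℕ} (ρ : DensityMatrix m) :
    ρ.subentropy = 1 - eulerMascheroniConstant -
      ∫ z, quadForm ρ.1 z * log (quadForm ρ.1 z) ∂gaussianVector (Fin m) := by
  rw [DensityMatrix.subentropy, spectralSubentropy_eq ρ.spectrum_mem, meanMulLog,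
    ρ.integral_comp_quadForm continuous_mul_log]

theorem continuous_quadForm (m : ℕ) :
    Continuous fun p : DensityMatrix m × EuclideanSpace ℂ (Fin m) => quadForm p.1.1 p.2 := by
  have h : Continuous fun ρ : DensityMatrix m => ρ.1 := continuous_subtype_val
  unfold quadForm
  fun_prop

instance (m : ℕ) : SecondCountableTopology (DensityMatrix m) :=
  have : SecondCountableTopology (Matrix (Fin m) (Fin m) ℂ) :=
    inferInstanceAs (SecondCountableTopology (Fin m → Fin m → ℂ))
  Topology.IsEmbedding.subtypeVal.secondCountableTopology

theorem measurable_subentropy (m : ℕ) : Measurable (DensityMatrix.subentropy (m := m)) := by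
  have h : Measurable fun p : DensityMatrix m × EuclideanSpace ℂ (Fin m) =>
      quadForm p.1.1 p.2 * log (quadForm p.1.1 p.2) :=
    (continuous_mul_log.comp (continuous_quadForm m)).measurable
  have h2 := (h.stronglyMeasurable.integral_prod_right' (ν := gaussianVector (Fin m))).measurable
  have h3 : (DensityMatrix.subentropy (m := m)) = fun ρ => 1 - eulerMascheroniConstant -
      ∫ z, quadForm ρ.1 z * log (quadForm ρ.1 z) ∂gaussianVector (Fin m) :=
    funext DensityMatrix.subentropy_eq
  rw [h3]
  exact measurable_const.sub h2

theorem integrable_subentropy {m : ℕ} (μ : Measure (DensityMatrix m)) [IsFiniteMeasure μ] :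
    Integrable DensityMatrix.subentropy μ := by
  obtain ⟨C, hC⟩ := exists_abs_spectralSubentropy_le m
  exact Integrable.of_bound (measurable_subentropy m).aestronglyMeasurable C
    (Filter.Eventually.of_forall fun ρ => hC _ ρ.spectrum_mem)

/-! ### Gram matrices of Gaussian matrices -/

/-- A sum of independent standard exponential variables is Gamma distributed. -/
theorem integral_sum_pi_gammaWeight (k : ℕ) {f : ℝ → ℝ} (hf : Measurable f) :
    ∫ x, f (∑ i, x i) ∂(Measure.pi fun _ : Fin (k + 1) => gammaWeight 0) =
      (k.factorial : ℝ)⁻¹ * ∫ r, f r ∂gammaWeight k := by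
  have key : ∀ g : ℝ → ℝ, Measurable g →
      ∫ x, g (∑ i, x i) ∂(Measure.pi fun _ : Fin (k + 1) => gammaWeight 0) =
        (simplexMeasure (k + 1)).real univ * ∫ r, g r ∂gammaWeight k := by
    intro g hg
    have hgs : Measurable fun x : Fin (k + 1) → ℝ => g (∑ i, x i) := hg.comp (by fun_prop)
    rw [pi_gammaWeight_zero_eq_map, integral_map (measurable_smul_prod _).aemeasurable
      hgs.aestronglyMeasurable]
    have h1 : ∀ᵐ p ∂(gammaWeight k).prod (simplexMeasure (k + 1)),
        p.2 ∈ stdSimplex ℝ (Fin (k + 1)) :=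
      Measure.quasiMeasurePreserving_snd.ae (ae_simplexMeasure_mem _)
    rw [integral_congr_ae (g := fun p => g p.1 * 1)]
    · rw [integral_prod_mul g fun _ : Fin (k + 1) → ℝ => (1 : ℝ)]
      simp [mul_comm]
    · filter_upwards [h1] with p hp
      simp only [Pi.smul_apply, smul_eq_mul, ← Finset.mul_sum]
      rw [hp.2, mul_one, mul_one]
  have hmass := key (fun _ => 1) measurable_const
  have h0 := integral_pow_gammaWeight k 0
  simp only [pow_zero, add_zero] at h0
  rw [h0] at hmass
  simp only [integral_const, probReal_univ, smul_eq_mul, mul_one] at hmass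
  rw [key f hf, eq_inv_of_mul_eq_one_left hmass.symm]

theorem integral_sum_mul_log_pi_gammaWeight (n : ℕ) :
    ∫ x, (∑ i, x i) * log (∑ i, x i) ∂(Measure.pi fun _ : Fin n => gammaWeight 0) =
      n * ((harmonic n : ℝ) - eulerMascheroniConstant) := by
  cases n with
  | zero => simp
  | succ k =>
    have h := integral_pow_log_gammaWeight k 1
    simp only [pow_one] at h
    rw [integral_sum_pi_gammaWeight k (f := fun s => s * log s) (by fun_prop), h,
      Nat.factorial_succ]
    have : (k.factorial : ℝ) ≠ 0 := by positivity
    push_cast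
    field_simp

/-- The quadratic form `⟨z, G G† z⟩` of the Gram matrix of an `m × n` matrix `G`, as the sum of the
squared overlaps of `z` with the columns of `G`. -/
noncomputable def gramForm {m n : ℕ} (G : EuclideanSpace ℂ (Fin m × Fin n))
    (z : EuclideanSpace ℂ (Fin m)) : ℝ :=
  ∑ k, ‖∑ i, star (z i) * G (i, k)‖ ^ 2

theorem continuous_gramForm (m n : ℕ) :
    Continuous fun p : EuclideanSpace ℂ (Fin m × Fin n) × EuclideanSpace ℂ (Fin m) =>
      gramForm p.1 p.2 := by
  unfold gramForm
  fun_prop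

theorem measurable_gramForm_left {m n : ℕ} (z : EuclideanSpace ℂ (Fin m)) :
    Measurable fun G : EuclideanSpace ℂ (Fin m × Fin n) => gramForm G z := by
  unfold gramForm
  exact Continuous.measurable (by fun_prop)

theorem gramForm_smul {m n : ℕ} (r : ℝ) (G : EuclideanSpace ℂ (Fin m × Fin n))
    (z : EuclideanSpace ℂ (Fin m)) : gramForm (r • G) z = r ^ 2 * gramForm G z := by
  rw [gramForm, gramForm, Finset.mul_sum]
  refine Finset.sum_congr rfl fun k _ => ?_
  have h : ∑ i, star (z i) * (r • G) (i, k) = (r : ℂ) * ∑ i, star (z i) * G (i, k) := by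
    rw [Finset.mul_sum]
    refine Finset.sum_congr rfl fun i _ => ?_
    simp only [PiLp.smul_apply, Complex.real_smul]
    ring
  rw [h, norm_mul, mul_pow, Complex.norm_real, norm_eq_abs, sq_abs]

theorem quadForm_reduced {m n : ℕ} (ψ : PureState m n) (z : EuclideanSpace ℂ (Fin m)) :
    quadForm ψ.reduced.1 z = gramForm ψ.1 z := by
  have h : star z.ofLp ⬝ᵥ (partialTraceRight ψ.projector).mulVec z.ofLp =
      ∑ k, (∑ i, star (z i) * ψ.1 (i, k)) * star (∑ j, star (z j) * ψ.1 (j, k)) := by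
    simp only [dotProduct, Matrix.mulVec, partialTraceRight, PureState.projector,
      Matrix.of_apply, Pi.star_apply, star_sum, star_mul', star_star, Finset.sum_mul_sum]
    rw [Finset.sum_comm]
    refine Finset.sum_congr rfl fun i _ => ?_
    rw [Finset.sum_comm, Finset.mul_sum]
    refine Finset.sum_congr rfl fun j _ => ?_
    rw [Finset.sum_mul, Finset.mul_sum]
    refine Finset.sum_congr rfl fun k _ => ?_
    ring
  rw [quadForm, gramForm]
  change (star z.ofLp ⬝ᵥ (partialTraceRight ψ.projector).mulVec z.ofLp).re = _
  rw [h, Complex.re_sum]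
  refine Finset.sum_congr rfl fun k _ => ?_
  rw [RCLike.star_def, Complex.mul_conj']
  norm_cast

/-- A matrix with independent identically distributed entries, as the family of its columns. -/
theorem pi_prod_eq_map {ι κ X : Type*} [Fintype ι] [Fintype κ] [MeasurableSpace X] (μ : Measure X)
    [IsProbabilityMeasure μ] :
    Measure.pi (fun _ : ι × κ => μ) =
      (Measure.pi fun _ : κ => Measure.pi fun _ : ι => μ).map fun x p => x p.2 p.1 := by
  have hm : Measurable fun (x : κ → ι → X) (p : ι × κ) => x p.2 p.1 := by fun_prop
  refine Measure.pi_eq fun s hs => ?_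
  have h : (fun (x : κ → ι → X) (p : ι × κ) => x p.2 p.1) ⁻¹' univ.pi s =
      univ.pi fun k => univ.pi fun i => s (i, k) := by
    ext x
    simp only [mem_preimage, mem_pi, mem_univ, forall_true_left, Prod.forall]
    exact forall_comm
  rw [Measure.map_apply hm (MeasurableSet.univ_pi hs), h, Measure.pi_pi]
  simp only [Measure.pi_pi]
  rw [Fintype.prod_prod_type_right]

theorem measurable_norm_sq_inner {m : ℕ} (z : EuclideanSpace ℂ (Fin m)) :
    Measurable fun x : Fin m → ℂ =>
      ‖inner ℂ z (WithLp.toLp 2 x : EuclideanSpace ℂ (Fin m))‖ ^ 2 :=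
  Continuous.measurable (by fun_prop)

theorem map_norm_sq_inner_pi_complexGaussian {m : ℕ} (z : EuclideanSpace ℂ (Fin m)) :
    (Measure.pi fun _ : Fin m => complexGaussian).map (fun x : Fin m → ℂ =>
      ‖inner ℂ z (WithLp.toLp 2 x : EuclideanSpace ℂ (Fin m))‖ ^ 2) =
      (gammaWeight 0).map fun t => ‖z‖ ^ 2 * t := by
  have h : Measurable fun g : EuclideanSpace ℂ (Fin m) => ‖inner ℂ z g‖ ^ 2 :=
    Continuous.measurable (by fun_prop)
  rw [← map_norm_sq_inner_gaussianVector, gaussianVector,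
    Measure.map_map h (measurable_toLp_complex _)]
  rfl

theorem gramForm_toLp_swap {m n : ℕ} (z : EuclideanSpace ℂ (Fin m)) (x : Fin n → Fin m → ℂ) :
    gramForm (WithLp.toLp 2 fun p : Fin m × Fin n => x p.2 p.1) z =
      ∑ k, ‖inner ℂ z (WithLp.toLp 2 (x k) : EuclideanSpace ℂ (Fin m))‖ ^ 2 := by
  simp only [gramForm, EuclideanSpace.inner_eq_star_dotProduct, dotProduct,
    Pi.star_apply, mul_comm]

theorem map_sum_pi {ι X : Type*} [Fintype ι] [MeasurableSpace X] (μ : Measure X)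
    [IsProbabilityMeasure μ] {φ : X → ℝ} (hφ : Measurable φ) :
    (Measure.pi fun _ : ι => μ).map (fun x => ∑ k, φ (x k)) =
      (Measure.pi fun _ : ι => μ.map φ).map fun y => ∑ k, y k := by
  have : IsProbabilityMeasure (μ.map φ) := Measure.isProbabilityMeasure_map hφ.aemeasurable
  have h : Measurable fun (x : ι → X) k => φ (x k) :=
    measurable_pi_iff.2 fun k => hφ.comp (measurable_pi_apply k)
  rw [← Measure.pi_map_pi (f := fun _ => φ) fun _ => hφ.aemeasurable,
    Measure.map_map (by fun_prop) h]
  rfl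

theorem gaussianVector_prod_eq_map (m n : ℕ) :
    gaussianVector (Fin m × Fin n) =
      (Measure.pi fun _ : Fin n => Measure.pi fun _ : Fin m => complexGaussian).map
        fun x => WithLp.toLp 2 fun p : Fin m × Fin n => x p.2 p.1 := by
  have h : Measurable fun (x : Fin n → Fin m → ℂ) (p : Fin m × Fin n) => x p.2 p.1 := by fun_prop
  rw [gaussianVector, pi_prod_eq_map, Measure.map_map (measurable_toLp_complex _) h]
  rfl

/-- For a Gaussian matrix `G`, the columns contribute independent exponential variables to
`⟨z, G G† z⟩`. -/
theorem map_gramForm_gaussianVector {m n : ℕ} (z : EuclideanSpace ℂ (Fin m)) :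
    (gaussianVector (Fin m × Fin n)).map (fun G => gramForm G z) =
      (Measure.pi fun _ : Fin n => gammaWeight 0).map fun y => ‖z‖ ^ 2 * ∑ k, y k := by
  have h : Measurable fun (x : Fin n → Fin m → ℂ) =>
      (WithLp.toLp 2 fun p : Fin m × Fin n => x p.2 p.1 : EuclideanSpace ℂ (Fin m × Fin n)) :=
    (measurable_toLp_complex _).comp (by fun_prop)
  have hz := map_sum_pi (ι := Fin n) (Measure.pi fun _ : Fin m => complexGaussian)
    (measurable_norm_sq_inner z)
  rw [map_norm_sq_inner_pi_complexGaussian, ← map_sum_pi (gammaWeight 0) (by fun_prop)] at hz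
  simp only [← Finset.mul_sum] at hz
  rw [← hz, gaussianVector_prod_eq_map, Measure.map_map (measurable_gramForm_left z) h]
  refine congrArg (fun f => Measure.map f _) (funext fun x => ?_)
  exact gramForm_toLp_swap z x

theorem map_norm_sq_gaussianVector (m : ℕ) :
    (gaussianVector (Fin m)).map (fun z => ‖z‖ ^ 2) =
      (Measure.pi fun _ : Fin m => gammaWeight 0).map fun x => ∑ i, x i := by
  rw [← map_norm_sq_repr_gaussianVector (EuclideanSpace.basisFun (Fin m) ℂ),
    Measure.map_map (by fun_prop) (by simp; fun_prop)]
  congr 1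
  ext z
  simp [EuclideanSpace.norm_sq_eq]

/-- For independent Gaussian `z` and `G`, the variable `⟨z, G G† z⟩` is distributed like the
product of two independent Gamma variables. -/
theorem map_gramForm_prod (m n : ℕ) :
    ((gaussianVector (Fin m × Fin n)).prod (gaussianVector (Fin m))).map
        (fun p => gramForm p.1 p.2) =
      ((Measure.pi fun _ : Fin m => gammaWeight 0).prod
        (Measure.pi fun _ : Fin n => gammaWeight 0)).map
          fun p => (∑ i, p.1 i) * ∑ k, p.2 k := by
  have hg := (continuous_gramForm m n).measurable
  have hs : Measurable fun p : (Fin m → ℝ) × (Fin n → ℝ) => (∑ i, p.1 i) * ∑ k, p.2 k := by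
    fun_prop
  refine Measure.ext_of_lintegral _ fun F hF => ?_
  have hFg : Measurable fun p : EuclideanSpace ℂ (Fin m × Fin n) × EuclideanSpace ℂ (Fin m) =>
      F (gramForm p.1 p.2) := hF.comp hg
  have hFs : Measurable fun p : (Fin m → ℝ) × (Fin n → ℝ) => F ((∑ i, p.1 i) * ∑ k, p.2 k) :=
    hF.comp hs
  rw [lintegral_map hF hg, lintegral_map hF hs, lintegral_prod_symm _ hFg.aemeasurable,
    lintegral_prod _ hFs.aemeasurable]
  have h1 : ∀ z : EuclideanSpace ℂ (Fin m),
      ∫⁻ G, F (gramForm G z) ∂gaussianVector (Fin m × Fin n) =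
        ∫⁻ y, F (‖z‖ ^ 2 * ∑ k, y k) ∂(Measure.pi fun _ : Fin n => gammaWeight 0) := by
    intro z
    rw [← lintegral_map hF (measurable_gramForm_left z),
      map_gramForm_gaussianVector, lintegral_map hF (by fun_prop)]
  simp only [h1]
  have h2 : Measurable fun s : ℝ =>
      ∫⁻ y, F (s * ∑ k, y k) ∂(Measure.pi fun _ : Fin n => gammaWeight 0) :=
    Measurable.lintegral_prod_right' (f := fun p : ℝ × (Fin n → ℝ) => F (p.1 * ∑ k, p.2 k))
      (hF.comp (by fun_prop))
  rw [← lintegral_map h2 (by fun_prop), map_norm_sq_gaussianVector, lintegral_map h2 (by fun_prop)]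

/-- `η(s) = s log s` satisfies `η(s t) = η(s) t + s η(t)`, so its mean at a product of independent
variables is given by the separate means. -/
theorem integrable_gramForm_mul_log (m n : ℕ) :
    Integrable (fun p => gramForm p.1 p.2 * log (gramForm p.1 p.2))
        ((gaussianVector (Fin m × Fin n)).prod (gaussianVector (Fin m))) ∧
      ∫ p, gramForm p.1 p.2 * log (gramForm p.1 p.2)
          ∂((gaussianVector (Fin m × Fin n)).prod (gaussianVector (Fin m))) =
        m * n * ((harmonic m : ℝ) + harmonic n - 2 * eulerMascheroniConstant) := by
  have hg := (continuous_gramForm m n).measurable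
  have hs : Measurable fun p : (Fin m → ℝ) × (Fin n → ℝ) => (∑ i, p.1 i) * ∑ k, p.2 k := by
    fun_prop
  have hη : Measurable fun s : ℝ => s * log s := by fun_prop
  have hmul : ∀ s t : ℝ, s * t * log (s * t) = s * log s * t + s * (t * log t) := by
    intro s t
    rcases eq_or_ne s 0 with rfl | hs0
    · simp
    rcases eq_or_ne t 0 with rfl | ht0
    · simp
    rw [log_mul hs0 ht0]
    ring
  have hi : ∀ n, Integrable (fun x : Fin n → ℝ => ∑ i, x i)
      (Measure.pi fun _ : Fin n => gammaWeight 0) := by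
    intro n
    simpa using hasQuadraticGrowth_id.integrable_sum (fun _ : Fin n => (1 : ℝ)) 0
  have hil : ∀ n, Integrable (fun x : Fin n → ℝ => (∑ i, x i) * log (∑ i, x i))
      (Measure.pi fun _ : Fin n => gammaWeight 0) := by
    intro n
    simpa using integrable_sum_mul_log (fun _ : Fin n => (1 : ℝ))
  have hI : ∀ n, ∫ x, ∑ i, x i ∂(Measure.pi fun _ : Fin n => gammaWeight 0) = n := by
    intro n
    simpa using integral_sum_mul_pi_gammaWeight (fun _ : Fin n => (1 : ℝ))
  have i1 := (hil m).mul_prod (hi n)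
  have i2 := (hi m).mul_prod (hil n)
  constructor
  · rw [← Function.comp_def (fun s : ℝ => s * log s) fun p : EuclideanSpace ℂ (Fin m × Fin n) ×
      EuclideanSpace ℂ (Fin m) => gramForm p.1 p.2,
      ← integrable_map_measure hη.aestronglyMeasurable hg.aemeasurable, map_gramForm_prod,
      integrable_map_measure hη.aestronglyMeasurable hs.aemeasurable]
    refine (i1.add i2).congr (Filter.Eventually.of_forall fun p => ?_)
    exact (hmul _ _).symm
  · rw [← integral_map (f := fun s : ℝ => s * log s) hg.aemeasurable hη.aestronglyMeasurable,
      map_gramForm_prod, integral_map hs.aemeasurable hη.aestronglyMeasurable]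
    simp only [hmul]
    rw [integral_add i1 i2,
      integral_prod_mul (fun x : Fin m → ℝ => (∑ i, x i) * log (∑ i, x i)) fun y : Fin n → ℝ => ∑ k, y k,
      integral_prod_mul (fun x : Fin m → ℝ => ∑ i, x i)
        fun y : Fin n → ℝ => (∑ k, y k) * log (∑ k, y k),
      hI, hI, integral_sum_mul_log_pi_gammaWeight, integral_sum_mul_log_pi_gammaWeight]
    ring

/-! ### The average over random mixed states -/

theorem isProbabilityMeasure_uniformPureState {m n : ℕ} (hm : 1 ≤ m) (hn : 1 ≤ n) :
    IsProbabilityMeasure (uniformPureState m n) := by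
  have : Nonempty (Fin m × Fin n) := ⟨⟨0, hm⟩, ⟨0, hn⟩⟩
  refine ⟨?_⟩
  rw [uniformPureState, Measure.smul_apply, smul_eq_mul]
  refine ENNReal.inv_mul_cancel ?_ (measure_ne_top _ _)
  rw [Ne, Measure.measure_univ_eq_zero]
  exact Measure.toSphere_ne_zero _

theorem measurable_sqrt_smul_pureState (m n : ℕ) :
    Measurable fun p : ℝ × PureState m n => √p.1 • (p.2 : EuclideanSpace ℂ (Fin m × Fin n)) := by
  fun_prop

/-- A Gaussian matrix is a uniformly distributed pure state times an independent radius whose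
square is Gamma distributed. -/
theorem gaussianVector_eq_map_uniformPureState {m n k : ℕ} (hk : m * n = k + 1) :
    gaussianVector (Fin m × Fin n) =
      (k.factorial : ENNReal)⁻¹ • ((gammaWeight k).prod (uniformPureState m n)).map
        fun p => √p.1 • (p.2 : EuclideanSpace ℂ (Fin m × Fin n)) := by
  have hpos : 0 < m * n := by omega
  have hprob := isProbabilityMeasure_uniformPureState (pos_of_mul_pos_left hpos (Nat.zero_le _))
    (pos_of_mul_pos_right hpos (Nat.zero_le _))
  obtain ⟨c, hc⟩ := exists_gaussianVector_eq_smul (Fin m × Fin n)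
  have hdim : Module.finrank ℝ (EuclideanSpace ℂ (Fin m × Fin n)) = 2 * (k + 1) := by
    rw [← Module.finrank_mul_finrank ℝ ℂ, Complex.finrank_real_complex, finrank_euclideanSpace,
      Fintype.card_prod, Fintype.card_fin, Fintype.card_fin, hk]
  have hS : (2 : ENNReal)⁻¹ • (volume : Measure (EuclideanSpace ℂ (Fin m × Fin n))).toSphere =
      (2⁻¹ * (volume : Measure (EuclideanSpace ℂ (Fin m × Fin n))).toSphere univ) •
        uniformPureState m n := by
    have : Nonempty (Fin m × Fin n) := ⟨⟨0, pos_of_mul_pos_left hpos (Nat.zero_le _)⟩,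
      ⟨0, pos_of_mul_pos_right hpos (Nat.zero_le _)⟩⟩
    rw [uniformPureState, smul_smul, mul_assoc, ENNReal.mul_inv_cancel _ (measure_ne_top _ _),
      mul_one]
    rw [Ne, Measure.measure_univ_eq_zero]
    exact Measure.toSphere_ne_zero _
  obtain ⟨c', hc'⟩ : ∃ c' : ENNReal, gaussianVector (Fin m × Fin n) =
      c' • ((gammaWeight k).prod (uniformPureState m n)).map
        fun p => √p.1 • (p.2 : EuclideanSpace ℂ (Fin m × Fin n)) := by
    refine ⟨c * (2⁻¹ * (volume : Measure (EuclideanSpace ℂ (Fin m × Fin n))).toSphere univ), ?_⟩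
    rw [hc, withDensity_gaussian_eq_map _ hdim, hS, Measure.prod_smul_right, Measure.map_smul,
      smul_smul]
  -- the constant is determined by the total mass
  have hmass : gammaWeight k univ = k.factorial := by
    have h := integral_pow_gammaWeight k 0
    simp only [pow_zero, add_zero, integral_const, smul_eq_mul, mul_one] at h
    rw [← ENNReal.ofReal_natCast, ← h, measureReal_def, ENNReal.ofReal_toReal (measure_ne_top _ _)]
  have h1 : gaussianVector (Fin m × Fin n) univ = 1 := measure_univ
  rw [hc', Measure.smul_apply, Measure.map_apply (measurable_sqrt_smul_pureState m n)
    MeasurableSet.univ, preimage_univ, ← univ_prod_univ, Measure.prod_prod, hmass,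
    measure_univ, mul_one, smul_eq_mul] at h1
  rw [hc', ENNReal.eq_inv_of_mul_eq_one_left h1]

theorem continuous_reduced (m n : ℕ) : Continuous (PureState.reduced (m := m) (n := n)) := by
  refine Continuous.subtype_mk ?_ _
  unfold partialTraceRight PureState.projector
  refine continuous_matrix fun i j => ?_
  simp only [Matrix.of_apply]
  fun_prop

/-- The average over Gaussian matrices `G` and vectors `z` of `η(⟨z, G G† z⟩)`, `η(s) = s log s`,
in terms of the average subentropy of the normalized `G G†`. -/
theorem integral_gramForm_mul_log_eq {m n : ℕ} (hm : 1 ≤ m) (hn : 1 ≤ n) :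
    ∫ p, gramForm p.1 p.2 * log (gramForm p.1 p.2)
        ∂((gaussianVector (Fin m × Fin n)).prod (gaussianVector (Fin m))) =
      m * n * (1 - eulerMascheroniConstant - ∫ ψ, ψ.reduced.subentropy ∂uniformPureState m n +
        (harmonic (m * n) - eulerMascheroniConstant)) := by
  obtain ⟨k, hk⟩ : ∃ k, m * n = k + 1 := ⟨m * n - 1, by have := Nat.mul_pos hm hn; omega⟩
  have hprob := isProbabilityMeasure_uniformPureState hm hn
  have hi := (integrable_gramForm_mul_log m n).1
  have hi2 : Integrable (fun G => ∫ z, gramForm G z * log (gramForm G z) ∂gaussianVector (Fin m))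
      (gaussianVector (Fin m × Fin n)) := hi.integral_prod_left
  have hmap := measurable_sqrt_smul_pureState m n
  have hk0 : (k.factorial : ENNReal)⁻¹ ≠ 0 := by simp
  rw [integral_prod _ hi]
  rw [gaussianVector_eq_map_uniformPureState hk] at hi2 ⊢
  have hmeas := hi2.aestronglyMeasurable.mono_ac (Measure.absolutelyContinuous_smul hk0)
  rw [integral_smul_measure, integral_map hmap.aemeasurable hmeas]
  -- the average over `z` at radius `√u` in the direction `ψ`
  have hinner : ∀ᵐ p ∂(gammaWeight k).prod (uniformPureState m n),
      ∫ z, gramForm (√p.1 • (p.2 : EuclideanSpace ℂ (Fin m × Fin n))) z *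
          log (gramForm (√p.1 • (p.2 : EuclideanSpace ℂ (Fin m × Fin n))) z)
        ∂gaussianVector (Fin m) =
      p.1 * (1 - eulerMascheroniConstant - p.2.reduced.subentropy) + p.1 * log p.1 * 1 := by
    have hpos : ∀ᵐ p ∂(gammaWeight k).prod (uniformPureState m n), 0 < p.1 :=
      Measure.quasiMeasurePreserving_fst.ae (ae_gammaWeight_pos k)
    filter_upwards [hpos] with p hp
    set q := fun z => quadForm p.2.reduced.1 z with hq
    have i1 : Integrable (fun z => q z * log (q z)) (gaussianVector (Fin m)) :=
      hasQuadraticGrowth_mul_log.integrable_quadForm _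
    have i2 : Integrable q (gaussianVector (Fin m)) :=
      hasQuadraticGrowth_id.integrable_quadForm _
    have h : ∀ z, gramForm (√p.1 • (p.2 : EuclideanSpace ℂ (Fin m × Fin n))) z *
        log (gramForm (√p.1 • (p.2 : EuclideanSpace ℂ (Fin m × Fin n))) z) =
        p.1 * (q z * log (q z)) + p.1 * log p.1 * q z := by
      intro z
      rw [gramForm_smul, sq_sqrt hp.le, ← quadForm_reduced]
      change p.1 * q z * log (p.1 * q z) = _
      rcases eq_or_ne (q z) 0 with h0 | h0
      · simp [h0]
      · rw [log_mul hp.ne' h0]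
        ring
    simp only [h]
    rw [integral_add (i1.const_mul _) (i2.const_mul _), integral_const_mul, integral_const_mul,
      p.2.reduced.integral_quadForm, p.2.reduced.subentropy_eq]
    ring
  have hu : Integrable (fun u : ℝ => u) (gammaWeight k) := by
    simpa using integrable_pow_gammaWeight k 1
  have hul : Integrable (fun u : ℝ => u * log u) (gammaWeight k) := by
    simpa using integrable_pow_log_gammaWeight k 0
  have hQ' : Integrable (fun ψ : PureState m n => ψ.reduced.subentropy) (uniformPureState m n) := by
    obtain ⟨C, hC⟩ := exists_abs_spectralSubentropy_le m
    exact Integrable.of_bound ((measurable_subentropy m).comp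
      (continuous_reduced m n).measurable).aestronglyMeasurable C
      (Filter.Eventually.of_forall fun ψ => hC _ ψ.reduced.spectrum_mem)
  have hQ : Integrable (fun ψ : PureState m n => 1 - eulerMascheroniConstant -
      ψ.reduced.subentropy) (uniformPureState m n) := (integrable_const _).sub hQ'
  have e1 := integral_pow_gammaWeight k 1
  have e2 := integral_pow_log_gammaWeight k 1
  simp only [pow_one] at e1 e2
  rw [integral_congr_ae hinner, integral_add (hu.mul_prod hQ)
    (hul.mul_prod (integrable_const (1 : ℝ))),
    integral_prod_mul (fun u : ℝ => u) fun ψ : PureState m n => 1 - eulerMascheroniConstant -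
      ψ.reduced.subentropy,
    integral_prod_mul (fun u : ℝ => u * log u) fun _ : PureState m n => (1 : ℝ), e1, e2,
    integral_sub (integrable_const _) hQ', integral_const, integral_const, probReal_univ,
    Nat.factorial_succ, hk, ENNReal.toReal_inv, ENNReal.toReal_natCast]
  have hkm : (m : ℝ) * n = k + 1 := by exact_mod_cast hk
  rw [hkm]
  have : (k.factorial : ℝ) ≠ 0 := by positivity
  simp only [smul_eq_mul, one_mul]
  push_cast
  field_simp

theorem integral_subentropy_inducedMeasure {m n : ℕ} (hm : 1 ≤ m) (hn : 1 ≤ n) :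
    Integrable DensityMatrix.subentropy (inducedMeasure m n) ∧
      ∫ ρ, DensityMatrix.subentropy ρ ∂(inducedMeasure m n) =
        1 + (harmonic (m * n) : ℝ) - harmonic m - harmonic n := by
  have hprob := isProbabilityMeasure_uniformPureState hm hn
  have hred := (continuous_reduced m n).measurable
  have hprob2 : IsProbabilityMeasure (inducedMeasure m n) :=
    Measure.isProbabilityMeasure_map hred.aemeasurable
  refine ⟨integrable_subentropy _, ?_⟩
  rw [inducedMeasure, integral_map hred.aemeasurable (measurable_subentropy m).aestronglyMeasurable]
  have h := (integrable_gramForm_mul_log m n).2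
  rw [integral_gramForm_mul_log_eq hm hn] at h
  have hmn : (m : ℝ) * n ≠ 0 := by positivity
  linarith [mul_left_cancel₀ hmn h]

/-! ### The limit and the supremum -/

/-- If `m ≤ n(m)`, then `H_{mn} - H_m - H_n → -γ`. -/
theorem tendsto_harmonic_mul_sub {n : ℕ → ℕ} (hn : ∀ m, m ≤ n m) :
    Filter.Tendsto (fun m : ℕ => 1 + (harmonic (m * n m) : ℝ) - harmonic m - harmonic (n m))
      Filter.atTop (nhds (1 - eulerMascheroniConstant)) := by
  have hn' : Filter.Tendsto n Filter.atTop Filter.atTop :=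
    Filter.tendsto_atTop_mono hn Filter.tendsto_id
  have hmn : Filter.Tendsto (fun m => m * n m) Filter.atTop Filter.atTop :=
    Filter.tendsto_id.atTop_mul_atTop₀ hn'
  have h1 := tendsto_harmonic_sub_log
  have h := (((h1.comp hmn).sub h1).sub (h1.comp hn')).const_add 1
  have e : 1 + (eulerMascheroniConstant - eulerMascheroniConstant - eulerMascheroniConstant) =
      1 - eulerMascheroniConstant := by ring
  rw [e] at h
  refine h.congr' ?_
  filter_upwards [Filter.eventually_ge_atTop 1] with m hm
  have hm0 : (m : ℝ) ≠ 0 := by positivity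
  have hn0 : (n m : ℝ) ≠ 0 := by have := hn m; exact_mod_cast (by omega : n m ≠ 0)
  simp only [Function.comp, Nat.cast_mul, log_mul hm0 hn0]
  ring

theorem tendsto_averageSubentropy {n : ℕ → ℕ} (hn : ∀ m, m ≤ n m) :
    Filter.Tendsto (fun m : ℕ => averageSubentropy m ((n m : ℝ) - (m : ℝ) + 1) 1)
      Filter.atTop (nhds (1 - eulerMascheroniConstant)) := by
  refine (tendsto_harmonic_mul_sub hn).congr' ?_
  filter_upwards [Filter.eventually_ge_atTop 1] with m hm
  exact (averageSubentropy_eq hm (hn m)).2.symm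

/-- The supremum is approached because some state lies above the average over random states. -/
theorem isLUB_subentropy :
    IsLUB {q : ℝ | ∃ (m : ℕ) (ρ : DensityMatrix m), q = ρ.subentropy}
      (1 - eulerMascheroniConstant) := by
  refine ⟨?_, fun B hB => ?_⟩
  · rintro q ⟨m, ρ, rfl⟩
    exact spectralSubentropy_le ρ.spectrum_mem
  · refine le_of_tendsto (tendsto_harmonic_mul_sub fun m => le_refl m) ?_
    filter_upwards [Filter.eventually_ge_atTop 1] with m hm
    have hprob := isProbabilityMeasure_uniformPureState hm hm
    have hprob2 : IsProbabilityMeasure (inducedMeasure m m) :=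
      Measure.isProbabilityMeasure_map (continuous_reduced m m).measurable.aemeasurable
    obtain ⟨hi, he⟩ := integral_subentropy_inducedMeasure hm hm
    rw [← he]
    calc ∫ ρ, DensityMatrix.subentropy ρ ∂(inducedMeasure m m)
        ≤ ∫ _, B ∂(inducedMeasure m m) :=
          integral_mono hi (integrable_const _) fun ρ => hB ⟨m, ρ, rfl⟩
      _ = B := by simp

theorem lemma1 :
    (∀ m n : ℕ, 1 ≤ m → m ≤ n →
      (MeasureTheory.Integrable DensityMatrix.subentropy (inducedMeasure m n) ∧
        ∫ ρ, DensityMatrix.subentropy ρ ∂(inducedMeasure m n) =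
          1 + (harmonic (m * n) : ℝ) - (harmonic m : ℝ) - (harmonic n : ℝ)) ∧
      (MeasureTheory.Integrable spectralSubentropy
          (eigenvalueMeasure m ((n : ℝ) - (m : ℝ) + 1) 1) ∧
        averageSubentropy m ((n : ℝ) - (m : ℝ) + 1) 1 =
          1 + (harmonic (m * n) : ℝ) - (harmonic m : ℝ) - (harmonic n : ℝ))) ∧
    (∀ n : ℕ → ℕ, (∀ m, m ≤ n m) →
      Filter.Tendsto (fun m : ℕ => averageSubentropy m ((n m : ℝ) - (m : ℝ) + 1) 1)
        Filter.atTop (nhds (1 - Real.eulerMascheroniConstant))) ∧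
    IsLUB {q : ℝ | ∃ (m : ℕ) (ρ : DensityMatrix m), q = ρ.subentropy}
      (1 - Real.eulerMascheroniConstant) := by
  refine ⟨fun m n hm hmn => ⟨?_, averageSubentropy_eq hm hmn⟩,
    fun n hn => tendsto_averageSubentropy hn, isLUB_subentropy⟩
  exact integral_subentropy_inducedMeasure hm (hm.trans hmn)
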